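/- A \emph{$d$-regular undirected multigraph $G$ on $n$ vertices with a two-way labeling} is given by its rotation map $\mathrm{Rot}_G\colon[n]\times[d]\to[n]\times[d]$, a map that is its own inverse; $\mathrm{Rot}_G(v,i)=(w,j)$ means that the $i$th edge at $v$ leads to $w$ and is the $j$th edge at $w$. If $G$ is such a $d$-regular multigraph on $n$ vertices and $H$ is such a $c$-regular multigraph on the vertex set $[d]$, the \emph{derandomized square} $G\mathbin{\text{\textcircled{s}}}H$ is the $(d\cdot c)$-regular multigraph on $[n]$, with edge labels in $[d]\times[c]$, whose rotation map sends $(v_0,(i_0,j_0))$ to $(v_2,(i_3,j_1))$, where $(v_1,i_1)=\mathrm{Rot}_G(v_0,i_0)$, $(i_2,j_1)=\mathrm{Rot}_H(i_1,j_0)$ and $(v_2,i_3)=\mathrm{Rot}_G(v_1,i_2)$. \textbf{Lemma.} Let $G_0$ be a $d$-regular undirected multigraph on $n$ vertices with a two-way labeling, and let $H_1,\dots,H_k$ be $c$-regular undirected multigraphs with two-way labelings, where for each $i\in[k]=\{1,\dots,k\}$ the graph $H_i$ has $d\cdot c^{i-1}$ vertices, identified with the edge labels $[d]\times[c]^{i-1}$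 of $G_{i-1}$. For each $i\in[k]$ let $G_i=G_{i-1}\mathbin{\text{\textcircled{s}}}H_i$. Then, given $G_0$ (as the table of its rotation map) on a read-only input tape, given $v_0\in[n]$, $i_0\in[d]\times[c]^{i-1}$ and $j_0\in[c]$ for some $i\in[k]$, and with oracle queries to $\mathrm{Rot}_{H_1},\dots,\mathrm{Rot}_{H_k}$, the value $\mathrm{Rot}_{G_i}(v_0,(i_0,j_0))$ can be computed in space \[ O\bigl(\log(n\cdot d)+k\cdot\log c\bigr), \] where $\log c$ is read as $\log\max(c,2)$, which matters only in the degenerate case $c=1$. More precisely, there are one deterministic multi-tape oracle Turing machine and one constant which work for all $n,d,c,k$, $G_0$, $H_1,\dots,H_k$, $i$ and $(v_0,(i_0,j_0))$, with the following conventions. Numbers are written in binary with a fixed width determined by their range, and components of tuples are separated by commas. Besides the input tape, the machine has a read-write data tape, a read-write query tape, and read-write work tapes. At the start the input head is at the leftmost symbol of $G_0$; the data tape contains $(v_0,(i_0,j_0))$, with the head at its rightmost symbol, a blank cell directly to its left, and otherwise arbitrary further data; all other read-write tapes are blank, with their heads at the origin. When the query tape carries precisely a pair in $([d]\times[c]^{i-1})\times[c]$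 for some $i \in [k]$, an oracle call replaces it by its image under $\mathrm{Rot}_{H_i}$. The machine halts with $\mathrm{Rot}_{G_i}(v_0,(i_0,j_0))$ in place of $(v_0,(i_0,j_0))$ on the data tape, with the head at its rightmost symbol and the rest of that tape unchanged, with the input head back at the leftmost symbol, and with all other read-write tapes blank and their heads at the origin. Its space is the number of cells visited on all read-write tapes, the data tape and the query tape included. -/

import Mathlib

/-! ### Labelled multigraphs, rotation maps and the derandomized square -/

/-- An undirected regular multigraph on the vertex set `V` with a two-way labelling, the edges at
each vertex being labelled by the elements of `L` (so the degree is the number of elements of `L`).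
It is specified by its rotation map: `rot (v, i) = (w, j)` means that the `i`-th edge at `v` leads
to `w` and is the `j`-th edge at `w`. The rotation maps are exactly the self-inverse maps. -/
structure LabeledGraph (V L : Type) where
  rot : V × L → V × L
  rot_rot : ∀ p, rot (rot p) = p

/-- The derandomized square of a graph `G` with edge labels in `D` and a graph `H` with vertex set
`D`. -/
def LabeledGraph.derandSquare {V D C : Type} (G : LabeledGraph V D) (H : LabeledGraph D C) :
    LabeledGraph V (D × C) where
  rot := fun p =>
    let a := G.rot (p.1, p.2.1)
    let b := H.rot (a.2, p.2.2)
    let e := G.rot (a.1, b.1)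
    (e.1, (e.2, b.2))
  rot_rot := by
    rintro ⟨v, i, j⟩
    simp [G.rot_rot, H.rot_rot]

/-- The edge labels of the `i`-th iterated derandomized square: `[d] × [c] × ⋯ × [c]` with `i`
factors `[c]`, bracketed to the left. -/
def EdgeLabel (d c : ℕ) : ℕ → Type
  | 0 => Fin d
  | i + 1 => EdgeLabel d c i × Fin c

/-- There are `d * c ^ i` labels: the `i`-th iterated square is `d * c ^ i`-regular, and the graph
with which it is squared next has `d * c ^ i` vertices. -/
theorem EdgeLabel.card (d c : ℕ) : ∀ i, Nat.card (EdgeLabel d c i) = d * c ^ i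
  | 0 => by simp [EdgeLabel]
  | i + 1 => by
    have h : Nat.card (EdgeLabel d c (i + 1)) = Nat.card (EdgeLabel d c i × Fin c) := rfl
    rw [h, Nat.card_prod, EdgeLabel.card d c i, Nat.card_fin, pow_succ, mul_assoc]

/-- The graphs `G_0 = G₀` and `G_{i+1} = G_i ⓢ H_{i+1}` for `i < k`. The graph `H_{i+1}`, which is
`c`-regular on `d * c ^ i` vertices, is written `H i`. -/
def iteratedSquare {n d c k : ℕ} (G₀ : LabeledGraph (Fin n) (Fin d))
    (H : (i : Fin k) → LabeledGraph (EdgeLabel d c i) (Fin c)) :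
    (i : ℕ) → i ≤ k → LabeledGraph (Fin n) (EdgeLabel d c i)
  | 0, _ => G₀
  | i + 1, h => (iteratedSquare G₀ H i (Nat.le_of_succ_le h)).derandSquare (H ⟨i, h⟩)

/-! ### Encodings -/

/-- The tape alphabet; a blank cell is `none : Option TapeSym`. -/
inductive TapeSym where
  | bit (b : Bool)
  | comma
  | semicolon
  deriving DecidableEq

/-- An element of `[m] = {0, …, m - 1}` in binary, with the fixed number `Nat.size m` of bits (the
number of binary digits of `m`), the least significant bit first. -/
def encodeFin {m : ℕ} (a : Fin m) : List TapeSym :=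
  (List.range m.size).map fun j => TapeSym.bit (a.val.testBit j)

/-- The label `(a, j_1, …, j_i)` is written as the list of its components, separated by commas. -/
def encodeLabel {d c : ℕ} : (i : ℕ) → EdgeLabel d c i → List TapeSym
  | 0, a => encodeFin (m := d) a
  | i + 1, p => encodeLabel i p.1 ++ TapeSym.comma :: encodeFin p.2

/-- A vertex `x` of `H_{i+1}` and an edge label `j` at `x`. This is the same word as the encoding
of the edge label `(x, j)` of the `(i+1)`-st iterated square. -/
def encodeQuery {d c : ℕ} (i : ℕ) (p : EdgeLabel d c i × Fin c) : List TapeSym :=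
  encodeLabel i p.1 ++ TapeSym.comma :: encodeFin p.2

/-- A vertex and an edge label, separated by a comma. -/
def encodePair {n d c : ℕ} (i : ℕ) (p : Fin n × EdgeLabel d c i) : List TapeSym :=
  encodeFin p.1 ++ TapeSym.comma :: encodeLabel i p.2

/-- The graph `G₀` is written as the table of its rotation map: for all vertices `v` and labels
`a`, in lexicographic order, the entry `v,a,w,b;` where `(w, b) = rot (v, a)`. -/
def encodeGraph {n d : ℕ} (G : LabeledGraph (Fin n) (Fin d)) : List TapeSym :=
  (List.finRange n).flatMap fun v => (List.finRange d).flatMap fun a =>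
    encodePair (c := 0) 0 (v, a) ++ TapeSym.comma :: encodePair (c := 0) 0 (G.rot (v, a)) ++
      [TapeSym.semicolon]

/-- The tape which carries the word `w` in the cells `0, …, w.length - 1` and agrees with `rest` in
all other cells. -/
def overlay (w : List TapeSym) (rest : ℤ → Option TapeSym) : ℤ → Option TapeSym := fun z =>
  if 0 ≤ z then (w[z.toNat]?).or (rest z) else rest z

/-- The tape which carries the word `w`, starting in the cell `0`, and is blank elsewhere. -/
def tapeOf (w : List TapeSym) : ℤ → Option TapeSym := overlay w fun _ => none

theorem tapeOf_injective : Function.Injective tapeOf := by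
  intro w w' h
  apply List.ext_getElem?
  intro j
  have := congrFun h (j : ℤ)
  simpa [tapeOf, overlay] using this

theorem encodeFin_injective {m : ℕ} : Function.Injective (encodeFin (m := m)) := by
  intro a b h
  apply Fin.ext
  apply Nat.eq_of_testBit_eq
  intro j
  by_cases hj : j < m.size
  · have := congrArg (fun l : List TapeSym => l[j]?) h
    simpa [encodeFin, hj] using this
  · have hm : m < 2 ^ j := Nat.size_le.mp (not_lt.mp hj)
    rw [Nat.testBit_lt_two_pow (a.2.trans hm), Nat.testBit_lt_two_pow (b.2.trans hm)]

theorem comma_notMem_encodeFin {m : ℕ} (a : Fin m) : TapeSym.comma ∉ encodeFin a := by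
  simp [encodeFin]

theorem encodeLabel_count {d c : ℕ} :
    ∀ (i : ℕ) (x : EdgeLabel d c i), (encodeLabel i x).count TapeSym.comma = i
  | 0, x => List.count_eq_zero.mpr (comma_notMem_encodeFin (m := d) x)
  | i + 1, x => by
    simp [encodeLabel, encodeLabel_count i x.1,
      List.count_eq_zero.mpr (comma_notMem_encodeFin x.2)]

theorem encodeLabel_injective {d c : ℕ} :
    ∀ i : ℕ, Function.Injective (encodeLabel (d := d) (c := c) i)
  | 0 => encodeFin_injective (m := d)
  | i + 1 => by
    rintro ⟨x, a⟩ ⟨y, b⟩ h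
    have h' := List.append_inj' h (by simp [encodeFin])
    have h1 := encodeLabel_injective i h'.1
    have h2 := encodeFin_injective (List.cons.inj h'.2).2
    simp only at h1 h2
    rw [h1, h2]

/-! ### Multi-tape oracle Turing machines and their space -/

open Classical in
/-- The effect on the query tape of a call of the oracle for the rotation maps of `H_1, …, H_k`.
If the tape carries a query `(x, j)` to the rotation map of some `H_{i+1}`, then the query is
replaced by the answer; any other tape is left as it is. The graph that is asked is determined by
the number of components of the query. -/
noncomputable def oracleCall {d c k : ℕ} (H : (i : Fin k) → LabeledGraph (EdgeLabel d c i) (Fin c))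
    (τ : ℤ → Option TapeSym) : ℤ → Option TapeSym :=
  if h : ∃ p : (i : Fin k) × (EdgeLabel d c i × Fin c), τ = tapeOf (encodeQuery p.1 p.2) then
    tapeOf (encodeQuery h.choose.1 ((H h.choose.1).rot h.choose.2))
  else τ

/-- Queries are unambiguous, and every query is answered correctly. -/
theorem oracleCall_query {d c k : ℕ} (H : (i : Fin k) → LabeledGraph (EdgeLabel d c i) (Fin c))
    (i : Fin k) (p : EdgeLabel d c i × Fin c) :
    oracleCall H (tapeOf (encodeQuery i p)) = tapeOf (encodeQuery i ((H i).rot p)) := by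
  have h : ∃ r : (i : Fin k) × (EdgeLabel d c i × Fin c),
      tapeOf (encodeQuery i p) = tapeOf (encodeQuery r.1 r.2) := ⟨⟨i, p⟩, rfl⟩
  have key : h.choose = ⟨i, p⟩ := by
    have hs := tapeOf_injective h.choose_spec
    generalize h.choose = r at hs
    obtain ⟨i', p'⟩ := r
    have hc : (i : ℕ) + 1 = (i' : ℕ) + 1 :=
      (encodeLabel_count (i + 1) p).symm.trans
        ((congrArg (List.count TapeSym.comma) hs).trans (encodeLabel_count (i' + 1) p'))
    obtain rfl : i = i' := Fin.ext (Nat.succ.inj hc)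
    have hp : p = p' := encodeLabel_injective (i + 1) hs
    rw [hp]
  rw [oracleCall, dif_pos h, key]

/-- What a machine does in one step: halt, call the oracle, or make an ordinary move. In an
ordinary move it enters the state `q`, moves its input head by `m`, and on each read-write tape `t`
writes `(w t).1` in the scanned cell and then moves the head by `(w t).2`. -/
inductive MachineAction (Q : Type) (tapes : ℕ) where
  | halt
  | query (q : Q)
  | move (q : Q) (m : SignType) (w : Fin (tapes + 2) → Option TapeSym × SignType)

/-- A deterministic oracle Turing machine with a read-only input tape and the read-write tapes
`0, …, workTapes + 1`. Tape `0` is the data tape, which carries the argument and finally the value;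
tape `1` is the query tape; the others are work tapes. All tapes are two-way infinite. -/
structure OracleMachine where
  Q : Type
  finite : Finite Q
  workTapes : ℕ
  start : Q
  /-- The action, as a function of the state, the scanned symbol of the input tape, and the scanned
  symbols of the read-write tapes. -/
  δ : Q → Option TapeSym → (Fin (workTapes + 2) → Option TapeSym) → MachineAction Q workTapes

namespace OracleMachine

/-- A configuration: the state, the position of the input head, and the contents and head
positions of the read-write tapes. -/
structure Cfg (M : OracleMachine) where
  state : M.Q
  inPos : ℤ
  tape : Fin (M.workTapes + 2) → ℤ → Option TapeSym
  pos : Fin (M.workTapes + 2) → ℤ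

variable (M : OracleMachine)

/-- The action that is due in a configuration, on the input word `x`. -/
def next (x : List TapeSym) (γ : M.Cfg) : MachineAction M.Q M.workTapes :=
  M.δ γ.state (tapeOf x γ.inPos) fun t => γ.tape t (γ.pos t)

/-- One step on the input word `x` with the oracle `O`. The input head cannot leave the input word
by more than one cell. A halted machine remains in its configuration. -/
def step (x : List TapeSym) (O : (ℤ → Option TapeSym) → ℤ → Option TapeSym) (γ : M.Cfg) : M.Cfg :=
  match M.next x γ with
  | .halt => γ
  | .query q => { γ with state := q, tape := Function.update γ.tape 1 (O (γ.tape 1)) }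
  | .move q m w =>
    { state := q
      inPos := max (-1) (min (x.length : ℤ) (γ.inPos + (m : ℤ)))
      tape := fun t => Function.update (γ.tape t) (γ.pos t) (w t).1
      pos := fun t => γ.pos t + ((w t).2 : ℤ) }

/-- The configuration after `T` steps. -/
def run (x : List TapeSym) (O : (ℤ → Option TapeSym) → ℤ → Option TapeSym) (γ : M.Cfg) (T : ℕ) : M.Cfg :=
  (M.step x O)^[T] γ

/-- The space used in the first `T` steps: the number of cells of read-write tapes that are scanned,
where the data tape and the query tape count as well. -/
def space (x : List TapeSym) (O : (ℤ → Option TapeSym) → ℤ → Option TapeSym) (γ : M.Cfg) (T : ℕ) : ℕ :=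
  ∑ t : Fin (M.workTapes + 2),
    ((Finset.range (T + 1)).image fun s => (M.run x O γ s).pos t).card

/-- The configuration by which arguments and values are passed: the state is `q`; the input head is
at the leftmost cell of the input; the data tape carries `y` in addition to the data `rest`, with
the head at the rightmost symbol of `y`; all other read-write tapes are blank, with their heads in
the cell `0`. -/
def ioCfg (q : M.Q) (y : List TapeSym) (rest : ℤ → Option TapeSym) : M.Cfg where
  state := q
  inPos := 0
  tape := fun t => if t = 0 then overlay y rest else fun _ => none
  pos := fun t => if t = 0 then (y.length : ℤ) - 1 else 0

/-- On the input `x` and with the oracle `O`, the machine turns the argument `y` on the data tape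
into the value `z` within space `s`, whatever else is on the data tape (the cell to the left of the
argument is blank and marks its beginning). It halts with the input head back at the start, with
`z` in the place of `y` and the rest of the data tape as before, and with all other read-write
tapes blank again. -/
def ComputesInSpace (x : List TapeSym) (O : (ℤ → Option TapeSym) → ℤ → Option TapeSym) (y z : List TapeSym)
    (s : ℝ) : Prop :=
  ∀ rest : ℤ → Option TapeSym, rest (-1) = none →
    ∃ (T : ℕ) (q : M.Q),
      M.run x O (M.ioCfg M.start y rest) T = M.ioCfg q z rest ∧
      M.next x (M.ioCfg q z rest) = MachineAction.halt ∧
      (M.space x O (M.ioCfg M.start y rest) T : ℝ) ≤ s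

end OracleMachine

/-! ### Building machines from gadgets -/

/-! Evaluating the rotation map of `G_i` takes two evaluations for `G_{i-1}` with one query to `H_i`
between them. The recursion is carried out in place: only one current vertex and one current label
of `G_i` are kept, and every component of the label is overwritten by its new value. All that is
remembered of the recursion is one separator per component from `[c]`. It is a comma until the
oracle of that level has been called, and a semicolon while the second inner evaluation is due or
running. The separators thus form a binary counter for the `2 ^ i` lookups in the table of `G₀`.
After a lookup, the leading semicolons belong to levels that are finished, and the first comma marks
the level whose oracle is due. Its query consists of exactly the components up to that comma. The
answer comes back with commas, which resets the lower digits, and its last separator is turned into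
a semicolon.

Correctness of this schedule is `exec_mainLoop`, by induction on the level, based on `exec_lookup`,
`exec_scan` and `exec_askOracle`. Machines are assembled from gadgets that treat each tape as a
stack; `Exec.act`, `Exec.call`, `Exec.seq` and the loop rules reduce a run to equations between
lists. No stack outgrows the encoded argument, of length `cap`, so every head stays in the cells
`-1, …, cap - 1`. Then `OracleMachine.space_le` and `encodedLength_le` give the bound. -/

instance : Finite TapeSym :=
  Finite.of_injective
    (fun s : TapeSym => match s with
      | .bit b => some (some b)
      | .comma => some none
      | .semicolon => none)
    (by rintro (_ | _ | _) (_ | _ | _) h <;> simp_all)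

/-- The action `a` with its successor state renamed. -/
def MachineAction.map {Q Q' : Type} {w : ℕ} (f : Q → Q') : MachineAction Q w → MachineAction Q' w
  | .halt => .halt
  | .query q => .query (f q)
  | .move q m a => .move (f q) m a

/-- The part of a configuration that is not the state. -/
@[ext]
structure Memory (w : ℕ) where
  inPos : ℤ
  tape : Fin (w + 2) → ℤ → Option TapeSym
  pos : Fin (w + 2) → ℤ

/-- A component of a machine; the successor state `none` means that the component is left. -/
structure Gadget (w : ℕ) where
  Q : Type
  finite : Finite Q
  start : Q
  δ : Q → Option TapeSym → (Fin (w + 2) → Option TapeSym) → MachineAction (Option Q) w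

/-- What a computation depends on: the input word, the oracle, the data tape outside of the cells
`0, …, cap - 1`, and a bound `cap` for the head positions. -/
structure Env where
  input : List TapeSym
  oracle : (ℤ → Option TapeSym) → ℤ → Option TapeSym
  base : ℤ → Option TapeSym
  base_neg : base (-1) = none
  cap : ℕ

namespace Memory

variable {w : ℕ}

def Within (E : Env) (μ : Memory w) : Prop := ∀ t, -1 ≤ μ.pos t ∧ μ.pos t < E.cap

def symbols (μ : Memory w) : Fin (w + 2) → Option TapeSym := fun t => μ.tape t (μ.pos t)

def move (E : Env) (μ : Memory w) (m : SignType) (a : Fin (w + 2) → Option TapeSym × SignType) :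
    Memory w where
  inPos := max (-1) (min (E.input.length : ℤ) (μ.inPos + (m : ℤ)))
  tape := fun t => Function.update (μ.tape t) (μ.pos t) (a t).1
  pos := fun t => μ.pos t + ((a t).2 : ℤ)

def query (E : Env) (μ : Memory w) : Memory w :=
  { μ with tape := Function.update μ.tape 1 (E.oracle (μ.tape 1)) }

end Memory

namespace Gadget

variable {w : ℕ}

/-- A computation of a gadget whose heads on the read-write tapes stay within `-1, …, cap - 1`. -/
inductive Path (E : Env) (g : Gadget w) : Option g.Q → Memory w → Option g.Q → Memory w → Prop
  | refl (o μ) : μ.Within E → Path E g o μ o μ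
  | move {q q' μ m a o' μ'} : μ.Within E →
      g.δ q (tapeOf E.input μ.inPos) μ.symbols = .move q' m a →
      Path E g q' (μ.move E m a) o' μ' → Path E g (some q) μ o' μ'
  | query {q q' μ o' μ'} : μ.Within E →
      g.δ q (tapeOf E.input μ.inPos) μ.symbols = .query q' →
      Path E g q' (μ.query E) o' μ' → Path E g (some q) μ o' μ'

theorem Path.trans {E : Env} {g : Gadget w} {o₁ o₂ o₃ : Option g.Q} {μ₁ μ₂ μ₃ : Memory w}
    (h : g.Path E o₁ μ₁ o₂ μ₂) (h' : g.Path E o₂ μ₂ o₃ μ₃) : g.Path E o₁ μ₁ o₃ μ₃ := by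
  induction h with
  | refl => exact h'
  | move hB hδ _ ih => exact .move hB hδ (ih h')
  | query hB hδ _ ih => exact .query hB hδ (ih h')

/-- Computations are preserved by embeddings of gadgets. -/
theorem Path.embed {E : Env} {g g' : Gadget w} (e : Option g.Q → Option g'.Q)
    (he : ∀ q, ∃ q', e (some q) = some q' ∧ ∀ i r, g'.δ q' i r = (g.δ q i r).map e)
    {o o' : Option g.Q} {μ μ' : Memory w} (h : g.Path E o μ o' μ') :
    g'.Path E (e o) μ (e o') μ' := by
  induction h with
  | refl _ _ hB => exact .refl _ _ hB
  | @move q _ _ _ _ _ _ hB hδ _ ih =>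
    obtain ⟨q', hq, hq'⟩ := he q
    rw [hq]
    exact .move hB (by rw [hq', hδ, MachineAction.map]) ih
  | @query q _ _ _ _ hB hδ _ ih =>
    obtain ⟨q', hq, hq'⟩ := he q
    rw [hq]
    exact .query hB (by rw [hq', hδ, MachineAction.map]) ih

/-- The machine which consists of one gadget, and halts when the gadget is left. -/
def toMachine (g : Gadget w) : OracleMachine where
  Q := Option g.Q
  finite := have := g.finite; inferInstance
  workTapes := w
  start := some g.start
  δ := fun o i r => match o with
    | none => .halt
    | some q => g.δ q i r

def cfg (g : Gadget w) (o : Option g.Q) (μ : Memory w) : g.toMachine.Cfg :=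
  ⟨o, μ.inPos, μ.tape, μ.pos⟩

/-- Carries the head bounds over to actual runs, for the space estimate. They include the last
configuration, because `refl` also demands `Within`. -/
theorem Path.run {E : Env} {g : Gadget w} {o o' : Option g.Q} {μ μ' : Memory w}
    (h : g.Path E o μ o' μ') :
    ∃ T, g.toMachine.run E.input E.oracle (g.cfg o μ) T = g.cfg o' μ' ∧
      ∀ s ≤ T, ∀ t, -1 ≤ (g.toMachine.run E.input E.oracle (g.cfg o μ) s).pos t ∧
        (g.toMachine.run E.input E.oracle (g.cfg o μ) s).pos t < E.cap := by
  have cons : ∀ {o o₁ o' : Option g.Q} {μ μ₁ μ' : Memory w}, μ.Within E →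
      g.toMachine.step E.input E.oracle (g.cfg o μ) = g.cfg o₁ μ₁ →
      (∃ T, g.toMachine.run E.input E.oracle (g.cfg o₁ μ₁) T = g.cfg o' μ' ∧
        ∀ s ≤ T, ∀ t, -1 ≤ (g.toMachine.run E.input E.oracle (g.cfg o₁ μ₁) s).pos t ∧
          (g.toMachine.run E.input E.oracle (g.cfg o₁ μ₁) s).pos t < E.cap) →
      ∃ T, g.toMachine.run E.input E.oracle (g.cfg o μ) T = g.cfg o' μ' ∧
        ∀ s ≤ T, ∀ t, -1 ≤ (g.toMachine.run E.input E.oracle (g.cfg o μ) s).pos t ∧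
          (g.toMachine.run E.input E.oracle (g.cfg o μ) s).pos t < E.cap := by
    rintro o o₁ o' μ μ₁ μ' hB hs ⟨T, hT, hpos⟩
    have hrun : ∀ s, g.toMachine.run E.input E.oracle (g.cfg o μ) (s + 1) =
        g.toMachine.run E.input E.oracle (g.cfg o₁ μ₁) s := fun s => by
      rw [OracleMachine.run, Function.iterate_succ_apply, hs, OracleMachine.run]
    refine ⟨T + 1, (hrun T).trans hT, ?_⟩
    rintro (_ | s) hsT
    · exact hB
    · rw [hrun s]
      exact hpos s (by omega)
  induction h with
  | refl _ _ hB =>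
    refine ⟨0, rfl, fun s hs => ?_⟩
    obtain rfl := Nat.le_zero.mp hs
    exact hB
  | @move q q' μ m a _ _ hB hδ _ ih =>
    refine cons hB ?_ ih
    have hn : g.toMachine.next E.input (g.cfg (some q) μ) = .move q' m a := hδ
    rw [OracleMachine.step, hn]
    rfl
  | @query q q' μ _ _ hB hδ _ ih =>
    refine cons hB ?_ ih
    have hn : g.toMachine.next E.input (g.cfg (some q) μ) = .query q' := hδ
    rw [OracleMachine.step, hn]
    rfl

/-- First `g`, then `g'`. -/
def seq (g g' : Gadget w) : Gadget w where
  Q := g.Q ⊕ g'.Q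
  finite := have := g.finite; have := g'.finite; inferInstance
  start := .inl g.start
  δ := fun q i r => match q with
    | .inl q => (g.δ q i r).map fun o => some (o.elim (.inr g'.start) .inl)
    | .inr q => (g'.δ q i r).map (Option.map .inr)

/-- The body `g` is repeated as long as the scanned symbols satisfy `b`. -/
def loop (b : Option TapeSym → (Fin (w + 2) → Option TapeSym) → Bool) (g : Gadget w) :
    Gadget w where
  Q := Option g.Q
  finite := have := g.finite; inferInstance
  start := none
  δ := fun q i r => match q with
    | none => .move (if b i r then some (some g.start) else none) 0 fun t => (r t, 0)
    | some q => (g.δ q i r).map some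

/-- One step of a machine. -/
def single (a : Fin (w + 2) → SignType) : Gadget w where
  Q := Unit
  finite := inferInstance
  start := ()
  δ := fun _ _ r => .move none 0 fun t => (r t, a t)

/-- A call of the oracle. -/
def call : Gadget w where
  Q := Unit
  finite := inferInstance
  start := ()
  δ := fun _ _ _ => .query none

theorem Path.seq {E : Env} {g g' : Gadget w} {μ₁ μ₂ μ₃ : Memory w}
    (h : g.Path E (some g.start) μ₁ none μ₂) (h' : g'.Path E (some g'.start) μ₂ none μ₃) :
    (g.seq g').Path E (some (g.seq g').start) μ₁ none μ₃ :=
  -- This embedding sends the exit of `g` to the start state of `g'`.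
  (h.embed (g' := g.seq g') (fun o => some (o.elim (.inr g'.start) .inl))
    fun q => ⟨.inl q, rfl, fun _ _ => rfl⟩).trans
    (h'.embed (g' := g.seq g') (Option.map .inr) fun q => ⟨.inr q, rfl, fun _ _ => rfl⟩)

theorem Path.single {E : Env} {a : Fin (w + 2) → SignType} {μ μ' : Memory w}
    (h : μ.Within E) (h' : μ'.Within E) (he : μ.move E 0 (fun t => (μ.symbols t, a t)) = μ') :
    (single a).Path E (some (single a).start) μ none μ' :=
  .move h rfl (he ▸ .refl _ _ (he ▸ h'))

end Gadget

/-! ### Stacks on tapes -/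

/-- The read-write tapes as stacks (with the top at the head of the list) and the position of the
input head. -/
structure StackState (w : ℕ) where
  inPos : ℤ
  stk : Fin (w + 2) → List TapeSym

inductive StackOp where
  | keep
  | pop
  | push (a : TapeSym)

namespace StackOp

def apply : StackOp → List TapeSym → List TapeSym
  | keep, l => l
  | pop, l => l.tail
  | push a, l => a :: l

/-- The symbol to be pushed. -/
def pushed : StackOp → Option TapeSym
  | push a => some a
  | _ => none

/-- The symbol with which the scanned symbol `r` is overwritten before the head moves. -/
def write : StackOp → Option TapeSym → Option TapeSym
  | pop, _ => none
  | _, r => r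

def shift : StackOp → Option TapeSym → SignType
  | keep, _ => 0
  -- The head of an empty stack scans a blank and stays in place, in accordance with `[].tail = []`.
  | pop, none => 0
  | pop, some _ => -1
  | push _, _ => 1

end StackOp

/-- The tape which carries a stack in the cells `0, …, cap - 1`. -/
def stackTape (cap : ℕ) (base : ℤ → Option TapeSym) (l : List TapeSym) : ℤ → Option TapeSym :=
  fun z => if 0 ≤ z ∧ z < cap then l.reverse[z.toNat]? else base z

/-- The head of an empty stack is in the cell `-1`; the blank there is what makes emptiness visible.
-/
theorem stackTape_top {cap : ℕ} {base : ℤ → Option TapeSym} (hb : base (-1) = none)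
    {l : List TapeSym} (hl : l.length ≤ cap) :
    stackTape cap base l ((l.length : ℤ) - 1) = l.head? := by
  cases l with
  | nil => simp [stackTape, hb]
  | cons a l =>
    simp only [List.length_cons] at hl
    have : (l.length : ℤ) < cap := by omega
    simp [stackTape, this]

theorem update_stackTape_pop {cap : ℕ} {base : ℤ → Option TapeSym} {a : TapeSym}
    {l : List TapeSym} (hl : l.length + 1 ≤ cap) :
    Function.update (stackTape cap base (a :: l)) (l.length : ℤ) none = stackTape cap base l := by
  funext z
  rcases eq_or_ne z l.length with rfl | hz
  · simp [stackTape]; omega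
  · rw [Function.update_of_ne hz]
    simp only [stackTape]
    split_ifs with h
    · simp only [List.reverse_cons]
      rcases lt_or_ge z.toNat l.length with h' | h'
      · rw [List.getElem?_append_left (by simpa using h')]
      · rw [List.getElem?_eq_none (by simp; omega), List.getElem?_eq_none (by simp; omega)]
    · rfl

theorem update_stackTape_push {cap : ℕ} {base : ℤ → Option TapeSym} {a : TapeSym}
    {l : List TapeSym} (hl : l.length + 1 ≤ cap) :
    Function.update (stackTape cap base l) (l.length : ℤ) (some a) =
      stackTape cap base (a :: l) := by
  rw [← update_stackTape_pop (a := a) hl, Function.update_idem, Function.update_eq_self_iff]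
  have : (l.length : ℤ) < cap := by omega
  simp [stackTape, this]

theorem stackTape_none {cap : ℕ} {l : List TapeSym} (hl : l.length ≤ cap) :
    stackTape cap (fun _ => none) l = tapeOf l.reverse := by
  funext z
  simp only [stackTape, tapeOf, overlay, Option.or_none]
  split_ifs with h h' h'
  · rfl
  · omega
  · rw [List.getElem?_eq_none (by simp; omega)]
  · rfl

/-- With `cap` equal to the length of the argument, the data tape is a full stack placed amid the
foreign data, and the computation cannot touch the latter. -/
theorem stackTape_reverse {base : ℤ → Option TapeSym} (y : List TapeSym) :
    stackTape y.length base y.reverse = overlay y base := by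
  funext z
  simp only [stackTape, overlay, List.reverse_reverse]
  split_ifs with h h' h'
  · rw [List.getElem?_eq_getElem (by omega), Option.some_or]
  · omega
  · rw [List.getElem?_eq_none (by omega), Option.none_or]
  · rfl

/-! ### Effect of gadgets on stacks -/

namespace StackState

variable {w : ℕ}

def Ok (E : Env) (s : StackState w) : Prop :=
  -1 ≤ s.inPos ∧ s.inPos ≤ E.input.length ∧ ∀ t, (s.stk t).length ≤ E.cap

def mem (E : Env) (s : StackState w) : Memory w where
  inPos := s.inPos
  tape := fun t => stackTape E.cap (if t = 0 then E.base else fun _ => none) (s.stk t)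
  pos := fun t => ((s.stk t).length : ℤ) - 1

def tops (s : StackState w) : Fin (w + 2) → Option TapeSym := fun t => (s.stk t).head?

theorem Ok.within {E : Env} {s : StackState w} (h : s.Ok E) : (s.mem E).Within E := fun t => by
  have := h.2.2 t
  simp only [mem]
  omega

theorem Ok.symbols {E : Env} {s : StackState w} (h : s.Ok E) : (s.mem E).symbols = s.tops := by
  funext t
  refine stackTape_top ?_ (h.2.2 t)
  split_ifs
  · exact E.base_neg
  · rfl

end StackState

namespace Gadget

variable {w : ℕ}

/-- The gadget takes the stacks and the input head from `s` to `s'`. -/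
def Exec (E : Env) (g : Gadget w) (s s' : StackState w) : Prop :=
  s.Ok E → s'.Ok E ∧ g.Path E (some g.start) (s.mem E) none (s'.mem E)

theorem Exec.seq {E : Env} {g g' : Gadget w} {s₁ s₂ s₃ : StackState w} (h : g.Exec E s₁ s₂)
    (h' : g'.Exec E s₂ s₃) : (g.seq g').Exec E s₁ s₃ := fun hs =>
  ⟨(h' (h hs).1).1, (h hs).2.seq (h' (h hs).1).2⟩

theorem Path.test {E : Env} {b : Option TapeSym → (Fin (w + 2) → Option TapeSym) → Bool}
    {g : Gadget w} {s : StackState w} (hs : s.Ok E) {o : Option (loop b g).Q} {μ : Memory w}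
    (h : (loop b g).Path E
      (if b (tapeOf E.input s.inPos) s.tops then some (some g.start) else none) (s.mem E) o μ) :
    (loop b g).Path E (some (loop b g).start) (s.mem E) o μ := by
  refine .move (q' := if b (tapeOf E.input s.inPos) s.tops then some (some g.start) else none)
    (m := 0) (a := fun t => (s.tops t, 0)) hs.within (by rw [hs.symbols]; rfl) ?_
  convert h using 1
  -- Within the range given by `Ok`, the clamping of the input head has no effect.
  have h1 := hs.1
  have h2 := hs.2.1
  rw [← hs.symbols]
  simp [Memory.move, StackState.mem, Memory.symbols, h1, h2]

theorem Exec.loop_false {E : Env} {b : Option TapeSym → (Fin (w + 2) → Option TapeSym) → Bool}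
    {g : Gadget w} {s : StackState w} (h : b (tapeOf E.input s.inPos) s.tops = false) :
    (loop b g).Exec E s s := fun hs => by
  refine ⟨hs, .test hs ?_⟩
  rw [h]
  exact .refl _ _ hs.within

theorem Exec.loop_true {E : Env} {b : Option TapeSym → (Fin (w + 2) → Option TapeSym) → Bool}
    {g : Gadget w} {s s' s'' : StackState w} (h : b (tapeOf E.input s.inPos) s.tops = true)
    (hg : g.Exec E s s') (hl : (loop b g).Exec E s' s'') : (loop b g).Exec E s s'' := fun hs => by
  refine ⟨(hl (hg hs).1).1, .test hs ?_⟩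
  rw [h]
  -- Under `some`, the exit `none` of the body becomes the test state of the loop.
  exact ((hg hs).2.embed (g' := loop b g) some fun q => ⟨some q, rfl, fun _ _ => rfl⟩).trans
    (hl (hg hs).1).2

/-- A simultaneous operation on all stacks, accompanied by a move of the input head. -/
def act (f : Option TapeSym → (Fin (w + 2) → Option TapeSym) →
    SignType × (Fin (w + 2) → StackOp)) : Gadget w where
  Q := Option (Fin (w + 2) → Option TapeSym)
  finite := inferInstance
  start := none
  -- A machine writes before it moves, but a push has to move before it writes. Hence there are two
  -- steps, and the second state remembers the symbols to be pushed.
  δ := fun q i r => match q with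
    | none => .move (some (some fun t => ((f i r).2 t).pushed)) (f i r).1
        fun t => (((f i r).2 t).write (r t), ((f i r).2 t).shift (r t))
    | some u => .move none 0 fun t => ((u t).or (r t), 0)

/-- Room is demanded only for stacks that grow, and the range only of an input head that moves;
everything else is inherited from `Ok`. -/
theorem Exec.act {E : Env} {f : Option TapeSym → (Fin (w + 2) → Option TapeSym) →
    SignType × (Fin (w + 2) → StackOp)} {s s' : StackState w} {m : SignType}
    {ops : Fin (w + 2) → StackOp} (hf : f (tapeOf E.input s.inPos) s.tops = (m, ops))
    (hm : s'.inPos = s.inPos + (m : ℤ))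
    (hi : s'.inPos = s.inPos ∨ -1 ≤ s'.inPos ∧ s'.inPos ≤ E.input.length)
    (ht : ∀ t, s'.stk t = (ops t).apply (s.stk t))
    (hc : ∀ t, (s'.stk t).length ≤ (s.stk t).length ∨ (s'.stk t).length ≤ E.cap) :
    (act f).Exec E s s' := fun hs => by
  have hi' : -1 ≤ s'.inPos ∧ s'.inPos ≤ E.input.length :=
    hi.elim (fun h => h ▸ ⟨hs.1, hs.2.1⟩) id
  have hs' : s'.Ok E := ⟨hi'.1, hi'.2, fun t => (hc t).elim (fun h => h.trans (hs.2.2 t)) id⟩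
  refine ⟨hs', ?_⟩
  refine .move (q' := some (some fun t => (ops t).pushed)) (m := m)
    (a := fun t => ((ops t).write (s.tops t), (ops t).shift (s.tops t))) hs.within
    (by rw [hs.symbols]; simp only [Gadget.act]; rw [StackState.mem, hf]) ?_
  have hpos : ((s.mem E).move E m
      fun t => ((ops t).write (s.tops t), (ops t).shift (s.tops t))).pos = (s'.mem E).pos := by
    funext t
    have h := ht t
    simp only [StackState.mem, Memory.move, StackState.tops, h]
    cases ops t with
    | keep => simp [StackOp.apply, StackOp.shift]
    | push a => simp [StackOp.apply, StackOp.shift]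
    | pop => cases s.stk t <;> simp [StackOp.apply, StackOp.shift, sub_eq_add_neg]
  refine .move (q' := none) (m := 0) (a := fun t => (((ops t).pushed).or
      (((s.mem E).move E m
        fun t => ((ops t).write (s.tops t), (ops t).shift (s.tops t))).symbols t), 0))
      ?_ rfl ?_
  · intro t
    rw [hpos]
    exact hs'.within t
  · convert Path.refl _ _ hs'.within using 1
    refine Memory.ext ?_ ?_ ?_
    · simp only [Memory.move, StackState.mem, SignType.coe_zero, add_zero, ← hm]
      omega
    · funext t
      have h := ht t
      have hl := hs.2.2 t
      have hl' := hs'.2.2 t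
      have htop : (s.mem E).tape t ((s.mem E).pos t) = s.tops t := congrFun hs.symbols t
      simp only [Memory.move, Memory.symbols]
      generalize ops t = op at h
      cases op with
      | keep =>
        simp only [StackOp.write, StackOp.shift, StackOp.pushed, ← htop]
        simp [StackState.mem, h, StackOp.apply]
      | push a =>
        simp only [StackOp.write, StackOp.shift, StackOp.pushed, ← htop]
        rw [h] at hl'
        simp only [StackOp.apply, List.length_cons] at hl'
        simp [StackState.mem, h, StackOp.apply, update_stackTape_push hl']
      | pop =>
        simp only [StackOp.write, StackOp.shift, StackOp.pushed]
        cases hst : s.stk t with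
        | nil =>
          simp only [StackState.tops, hst] at htop ⊢
          simp only [List.head?_nil] at htop ⊢
          rw [← htop]
          simp [StackState.mem, h, hst, StackOp.apply]
        | cons a l =>
          rw [hst] at hl
          simp only [List.length_cons] at hl
          simp [StackState.mem, StackState.tops, h, hst, StackOp.apply, update_stackTape_pop hl]
          rw [← update_stackTape_pop (a := a) hl, Function.update_of_ne (by omega)]
    · rw [← hpos]
      simp [Memory.move]

/-- The oracle moves no head, so the answer must be as long as the query for the head to be on the
top of the new stack. -/
theorem Exec.call {E : Env} {s s' : StackState w} (hp : s'.inPos = s.inPos)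
    (h : E.oracle (tapeOf (s.stk 1).reverse) = tapeOf (s'.stk 1).reverse)
    (hl : (s'.stk 1).length = (s.stk 1).length) (ht : ∀ t, t ≠ 1 → s'.stk t = s.stk t) :
    (call (w := w)).Exec E s s' := fun hs => by
  have hlen : ∀ t, (s'.stk t).length = (s.stk t).length := fun t => by
    by_cases h1 : t = 1
    · rw [h1, hl]
    · rw [ht t h1]
  have hs' : s'.Ok E := ⟨hp ▸ hs.1, hp ▸ hs.2.1, fun t => by rw [hlen]; exact hs.2.2 t⟩
  have he : (s.mem E).query E = s'.mem E := by
    refine Memory.ext hp.symm ?_ (by simp only [Memory.query, StackState.mem, hlen])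
    funext t
    simp only [Memory.query, StackState.mem]
    by_cases h1 : t = 1
    · subst h1
      have hne : (1 : Fin (w + 2)) ≠ 0 := by simp
      rw [Function.update_self, if_neg hne, stackTape_none (hs.2.2 1), stackTape_none (hs'.2.2 1),
        h]
    · rw [Function.update_of_ne h1, ht t h1]
  refine ⟨hs', .query hs.within rfl ?_⟩
  rw [he]
  exact .refl _ _ hs'.within

end Gadget

/-! ### Elementary gadgets -/

namespace Gadget

variable {w : ℕ} {E : Env}

/-- Symbols that satisfy `p` are moved from the stack `t` to the stack `u`. -/
def transfer (p : TapeSym → Bool) (t u : Fin (w + 2)) : Gadget w :=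
  loop (fun _ r => (r t).any p) (act fun _ r => (0, fun j =>
    if j = t then .pop else if j = u then (r t).elim .keep .push else .keep))

/-- Each round moves one symbol, and `hr` stops the loop. The contents are described stack by stack,
so that uses with concrete stacks reduce to a case check. -/
theorem exec_transfer {p : TapeSym → Bool} {t u : Fin (w + 2)} (htu : t ≠ u) {z : ℤ}
    {σ σ' : Fin (w + 2) → List TapeSym} (l r : List TapeSym) (hl : ∀ a ∈ l, p a = true)
    (hr : r.head?.any p = false) (ht : σ t = l ++ r) (ht' : σ' t = r)
    (hu : σ' u = l.reverse ++ σ u) (ho : ∀ j, j ≠ t → j ≠ u → σ' j = σ j)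
    (hcap : (σ' u).length ≤ E.cap) : (transfer p t u).Exec E ⟨z, σ⟩ ⟨z, σ'⟩ := by
  induction l generalizing σ with
  | nil =>
    have hσ : σ' = σ := by
      funext j
      by_cases h1 : j = t
      · rw [h1, ht, ht', List.nil_append]
      · by_cases h2 : j = u
        · rw [h2, hu, List.reverse_nil, List.nil_append]
        · exact ho j h1 h2
    rw [hσ]
    refine .loop_false ?_
    simpa [StackState.tops, ht] using hr
  | cons a l ih =>
    have ha := hl a (by simp)
    refine .loop_true (s' := ⟨z, Function.update (Function.update σ t (l ++ r)) u (a :: σ u)⟩)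
      (by simpa [StackState.tops, ht] using ha) ?_ ?_
    · refine .act rfl (by simp) (.inl rfl) (fun j => ?_) (fun j => ?_)
      · by_cases h2 : j = u
        · subst h2
          simp [StackState.tops, htu.symm, ht, StackOp.apply]
        · by_cases h1 : j = t
          · subst h1
            simp [h2, ht, StackOp.apply]
          · simp [h1, h2, StackOp.apply]
      · by_cases h2 : j = u
        · subst h2
          right
          simp only [hu, List.length_append, List.length_reverse, List.length_cons] at hcap
          simp only [Function.update_self, List.length_cons]
          omega
        · by_cases h1 : j = t
          · subst h1
            left
            simp [h2, ht]
          · left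
            simp [h1, h2]
    · refine ih (fun b hb => hl b (by simp [hb])) ?_ ?_ ?_
      · simp [htu]
      · simp [hu]
      · intro j h1 h2
        simp [h1, h2, ho j h1 h2]

/-- The stack `t` is emptied. -/
def drain (t : Fin (w + 2)) : Gadget w :=
  loop (fun _ r => (r t).isSome) (act fun _ _ => (0, fun j => if j = t then .pop else .keep))

theorem exec_drain {t : Fin (w + 2)} {z : ℤ} {σ σ' : Fin (w + 2) → List TapeSym}
    (ht : σ' t = []) (ho : ∀ j, j ≠ t → σ' j = σ j) : (drain t).Exec E ⟨z, σ⟩ ⟨z, σ'⟩ := by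
  generalize hl : σ t = l
  induction l generalizing σ with
  | nil =>
    have hσ : σ' = σ := by
      funext j
      by_cases h1 : j = t
      · rw [h1, ht, hl]
      · exact ho j h1
    rw [hσ]
    exact .loop_false (by simp [StackState.tops, hl])
  | cons a l ih =>
    refine .loop_true (s' := ⟨z, Function.update σ t l⟩) (by simp [StackState.tops, hl])
      (.act rfl (by simp) (.inl rfl) (fun j => ?_) (fun j => .inl ?_)) (ih (fun j h => ?_) (by simp))
    · by_cases h1 : j = t
      · subst h1
        simp [hl, StackOp.apply]
      · simp [h1, StackOp.apply]
    · by_cases h1 : j = t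
      · subst h1
        simp [hl]
      · simp [h1]
    · rw [ho j h, Function.update_of_ne h]

/-- The top of the stack `t` is removed, and `a` is pushed on the stack `u`. -/
def exchange (t u : Fin (w + 2)) (a : TapeSym) : Gadget w :=
  act fun _ _ => (0, fun j => if j = t then .pop else if j = u then .push a else .keep)

theorem exec_exchange {t u : Fin (w + 2)} {a : TapeSym} (htu : t ≠ u) {z : ℤ}
    {σ σ' : Fin (w + 2) → List TapeSym} (ht : σ' t = (σ t).tail) (hu : σ' u = a :: σ u)
    (ho : ∀ j, j ≠ t → j ≠ u → σ' j = σ j) (hcap : (σ' u).length ≤ E.cap) :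
    (exchange t u a).Exec E ⟨z, σ⟩ ⟨z, σ'⟩ := by
  refine .act rfl (by simp) (.inl rfl) (fun j => ?_) (fun j => ?_)
  · by_cases h1 : j = t
    · subst h1
      simp [ht, StackOp.apply]
    · by_cases h2 : j = u
      · subst h2
        simp [hu, htu.symm, StackOp.apply]
      · simp [h1, h2, ho, StackOp.apply]
  · by_cases h1 : j = t
    · subst h1
      simp [ht]
    · by_cases h2 : j = u
      · subst h2
        exact .inr hcap
      · simp [h1, h2, ho]

/-- The symbol `a` is pushed on the stack `u`. -/
def put (u : Fin (w + 2)) (a : TapeSym) : Gadget w :=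
  act fun _ _ => (0, fun j => if j = u then .push a else .keep)

theorem exec_put {u : Fin (w + 2)} {a : TapeSym} {z : ℤ}
    {σ σ' : Fin (w + 2) → List TapeSym} (hu : σ' u = a :: σ u)
    (ho : ∀ j, j ≠ u → σ' j = σ j) (hcap : (σ' u).length ≤ E.cap) :
    (put u a).Exec E ⟨z, σ⟩ ⟨z, σ'⟩ := by
  refine .act rfl (by simp) (.inl rfl) (fun j => ?_) (fun j => ?_)
  · by_cases h2 : j = u
    · subst h2
      simp [hu, StackOp.apply]
    · simp [h2, ho, StackOp.apply]
  · by_cases h2 : j = u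
    · subst h2
      exact .inr hcap
    · simp [h2, ho]

/-- The top of the stack `t` is removed. -/
def drop (t : Fin (w + 2)) : Gadget w :=
  act fun _ _ => (0, fun j => if j = t then .pop else .keep)

theorem exec_drop {t : Fin (w + 2)} {z : ℤ}
    {σ σ' : Fin (w + 2) → List TapeSym} (ht : σ' t = (σ t).tail)
    (ho : ∀ j, j ≠ t → σ' j = σ j) :
    (drop t).Exec E ⟨z, σ⟩ ⟨z, σ'⟩ := by
  refine .act rfl (by simp) (.inl rfl) (fun j => ?_) (fun j => ?_)
  · by_cases h1 : j = t
    · subst h1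
      simp [ht, StackOp.apply]
    · simp [h1, ho, StackOp.apply]
  · by_cases h1 : j = t
    · subst h1
      simp [ht]
    · simp [h1, ho]

/-- The input head is moved to the right. -/
def forward : Gadget w := act fun _ _ => (1, fun _ => .keep)

theorem exec_forward {z z' : ℤ} {σ : Fin (w + 2) → List TapeSym} (hz : z' = z + 1) (h : 0 ≤ z')
    (h' : z' ≤ E.input.length) : (forward (w := w)).Exec E ⟨z, σ⟩ ⟨z', σ⟩ :=
  .act rfl hz (.inr ⟨by simp only; omega, h'⟩) (fun _ => rfl) fun _ => .inl le_rfl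

/-- The input head, on the input, is moved to its leftmost symbol. -/
def rewind : Gadget w :=
  (loop (fun i _ => i.isSome) (act fun _ _ => (-1, fun _ => .keep))).seq forward

theorem tapeOf_append_cons (l r : List TapeSym) (a : TapeSym) :
    tapeOf (l ++ a :: r) l.length = some a := by
  simp [tapeOf, overlay]

/-- The input has no gaps, so the first blank to the left is in the cell `-1`. -/
theorem exec_rewind {z : ℕ} {σ : Fin (w + 2) → List TapeSym} (h : z < E.input.length) :
    (rewind (w := w)).Exec E ⟨z, σ⟩ ⟨0, σ⟩ := by
  refine .seq (s₂ := ⟨-1, σ⟩) ?_ (exec_forward (by omega) le_rfl (by omega))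
  have hz : ∀ z : ℕ, z < E.input.length → (tapeOf E.input z).isSome = true := fun z h => by
    simp [tapeOf, overlay, h]
  induction z with
  | zero =>
    exact .loop_true (s' := ⟨-1, σ⟩) (hz 0 h) (.act rfl rfl (.inr (by simp)) (fun _ => rfl)
      fun _ => .inl le_rfl) (.loop_false (by simp [tapeOf, overlay]))
  | succ z ih =>
    refine .loop_true (s' := ⟨z, σ⟩) (hz _ h) (.act rfl (by simp) (.inr ?_) (fun _ => rfl)
      fun _ => .inl le_rfl) (ih (by omega))
    simp only
    omega

/-- Input symbols up to the next semicolon are pushed on the stack `u`. -/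
def readEntry (u : Fin (w + 2)) : Gadget w :=
  loop (fun i _ => i ≠ some .semicolon)
    (act fun i _ => (1, fun j => if j = u then i.elim .keep .push else .keep))

/-- The input head stops on the semicolon, not behind it. -/
theorem exec_readEntry {u : Fin (w + 2)} (pre l post : List TapeSym)
    (hx : E.input = pre ++ l ++ .semicolon :: post) (hl : .semicolon ∉ l)
    {σ σ' : Fin (w + 2) → List TapeSym} (hu : σ' u = l.reverse ++ σ u)
    (ho : ∀ j, j ≠ u → σ' j = σ j) (hcap : (σ' u).length ≤ E.cap) :
    (readEntry u).Exec E ⟨pre.length, σ⟩ ⟨(pre ++ l).length, σ'⟩ := by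
  induction l generalizing σ pre with
  | nil =>
    have hσ : σ' = σ := by
      funext j
      by_cases h2 : j = u
      · rw [h2, hu, List.reverse_nil, List.nil_append]
      · exact ho j h2
    rw [hσ, List.append_nil]
    refine .loop_false ?_
    rw [hx, List.append_nil, tapeOf_append_cons]
    simp
  | cons a l ih =>
    have ha : a ≠ .semicolon := fun h => hl (by simp [h])
    have hi : tapeOf E.input pre.length = some a := by
      rw [hx, List.append_assoc, List.cons_append, tapeOf_append_cons]
    have hx' : E.input = (pre ++ [a]) ++ l ++ .semicolon :: post := by simp [hx]
    refine .loop_true (s' := ⟨(pre ++ [a]).length, Function.update σ u (a :: σ u)⟩)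
      (by simp [hi, ha])
      (.act (by simp only; rw [hi]) (by simp) (.inr ?_) (fun j => ?_) (fun j => ?_)) ?_
    · simp [hx]
      omega
    · by_cases h2 : j = u
      · subst h2
        simp [StackOp.apply]
      · simp [h2, StackOp.apply]
    · by_cases h2 : j = u
      · subst h2
        right
        simp only [hu, List.length_append, List.length_reverse, List.length_cons] at hcap
        simp only [Function.update_self, List.length_cons]
        omega
      · simp [h2]
    · have := ih (pre ++ [a]) hx' (fun h => hl (by simp [h])) (σ := Function.update σ u (a :: σ u))
        (by simp [hu]) (fun j h => by simp [h, ho])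
      rwa [List.append_assoc, List.singleton_append] at this

end Gadget

/-! ### Words -/

def TapeSym.isBit : TapeSym → Bool
  | .bit _ => true
  | _ => false

theorem isBit_of_mem_encodeFin {m : ℕ} (a : Fin m) : ∀ s ∈ encodeFin a, s.isBit = true := by
  simp [encodeFin, TapeSym.isBit]

theorem length_encodeFin {m : ℕ} (a : Fin m) : (encodeFin a).length = m.size := by
  simp [encodeFin]

/-- The first component of an edge label. -/
def EdgeLabel.first {d c : ℕ} : (i : ℕ) → EdgeLabel d c i → Fin d
  | 0, a => a
  | i + 1, x => EdgeLabel.first i x.1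

/-- The other components of an edge label, each of them preceded by `a`. -/
def EdgeLabel.tagged {d c : ℕ} (a : TapeSym) : (i : ℕ) → EdgeLabel d c i → List TapeSym
  | 0, _ => []
  | i + 1, x => EdgeLabel.tagged a i x.1 ++ a :: encodeFin x.2

theorem encodeLabel_eq {d c : ℕ} : ∀ (i : ℕ) (x : EdgeLabel d c i),
    encodeLabel i x = encodeFin (x.first i) ++ x.tagged .comma i
  | 0, x => by simp [encodeLabel, EdgeLabel.first, EdgeLabel.tagged]
  | i + 1, x => by
    rw [encodeLabel, encodeLabel_eq i x.1, EdgeLabel.first, EdgeLabel.tagged, List.append_assoc]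

theorem EdgeLabel.length_tagged {d c : ℕ} (a : TapeSym) : ∀ (i : ℕ) (x : EdgeLabel d c i),
    (x.tagged a i).length = i * (c.size + 1)
  | 0, x => by simp [EdgeLabel.tagged]
  | i + 1, x => by
    rw [EdgeLabel.tagged, List.length_append, EdgeLabel.length_tagged a i x.1, List.length_cons,
      length_encodeFin]
    ring

/-- The stack `l` does not begin with a bit. -/
def StartsNoBit (l : List TapeSym) : Prop := l.head?.any TapeSym.isBit = false

/-- The word is `r` itself for `i = 0` and begins with the tag otherwise. A transfer of bits
therefore stops in front of it. -/
theorem StartsNoBit.tagged_append {d c : ℕ} {a : TapeSym} (ha : a.isBit = false)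
    {r : List TapeSym} : ∀ (i : ℕ) (x : EdgeLabel d c i) (_ : StartsNoBit r),
    StartsNoBit (x.tagged a i ++ r)
  | 0, _, h => h
  | i + 1, x, _ => by
    rw [EdgeLabel.tagged, List.append_assoc, List.cons_append]
    exact StartsNoBit.tagged_append ha i x.1 (by simp [StartsNoBit, ha])

/-- A vertex and an edge label of `G₀`, as they appear in the table. -/
def encodeKey {n d : ℕ} (p : Fin n × Fin d) : List TapeSym :=
  encodeFin p.1 ++ .comma :: encodeFin p.2

theorem length_encodeKey {n d : ℕ} (p : Fin n × Fin d) :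
    (encodeKey p).length = n.size + 1 + d.size := by
  simp [encodeKey, length_encodeFin]
  ring

theorem encodeKey_injective {n d : ℕ} : Function.Injective (encodeKey (n := n) (d := d)) := by
  rintro ⟨v, a⟩ ⟨v', a'⟩ h
  have h' := List.append_inj h (by simp [length_encodeFin])
  exact Prod.ext (encodeFin_injective h'.1) (encodeFin_injective (List.cons.inj h'.2).2)

theorem semicolon_notMem_encodeKey {n d : ℕ} (p : Fin n × Fin d) :
    TapeSym.semicolon ∉ encodeKey p := by
  simp [encodeKey, encodeFin]

/-- An entry of the table of `G`. -/
def encodeEntry {n d : ℕ} (G : LabeledGraph (Fin n) (Fin d)) (p : Fin n × Fin d) : List TapeSym :=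
  encodeKey p ++ (.comma :: encodeKey (G.rot p)) ++ [.semicolon]

/-- As one flat list of entries, the table can be searched by a single induction. -/
theorem encodeGraph_eq {n d : ℕ} (G : LabeledGraph (Fin n) (Fin d)) :
    encodeGraph G = ((List.finRange n).flatMap fun v => (List.finRange d).map fun a =>
      (v, a)).flatMap (encodeEntry G) := by
  rw [List.flatMap_assoc]
  simp only [List.flatMap_map]
  rfl

/-! ### The algorithm -/

namespace Gadget

/-- The stacks: data, oracle queries, labels that are still to be read, current vertex and label
of `G₀`, auxiliary stack, current vertex, and a mark. -/
def ofStacks (z : ℤ) (d q s p t v f : List TapeSym) : StackState 5 := ⟨z, ![d, q, s, p, t, v, f]⟩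

/-! ### Table lookup -/

variable {E : Env}

/-- The stack `3` is compared with the input; it is reversed onto the stack `4`, and a mark is left
on the stack `6` if there is a mismatch. -/
def compare : Gadget 5 :=
  loop (fun _ r => (r 3).isSome) (act fun i r =>
    (1, ![.keep, .keep, .keep, .pop, (r 3).elim .keep .push, .keep,
      if (r 6).isNone ∧ r 3 ≠ i then .push .comma else .keep]))

/-- The comparison continues after a mismatch. Since keys have a fixed width, the input head always
ends directly behind the key of the entry, and the sought key can be restored from the stack `4`. -/
theorem exec_compare (k k' pre post : List TapeSym) (hk : k.length = k'.length)
    (hx : E.input = pre ++ k' ++ post) {d q s t v f : List TapeSym}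
    (hf : f = [] ∨ f = [.comma]) (hcap : k.length + t.length ≤ E.cap) (hcap' : 1 ≤ E.cap) :
    compare.Exec E (ofStacks pre.length d q s k t v f)
      (ofStacks (pre ++ k').length d q s [] (k.reverse ++ t) v
        (if f = [] ∧ k = k' then [] else [.comma])) := by
  induction k generalizing k' pre t f with
  | nil =>
    obtain rfl := List.length_eq_zero_iff.mp hk.symm
    have : (if f = [] ∧ ([] : List TapeSym) = [] then [] else [.comma]) = f := by
      rcases hf with rfl | rfl <;> simp
    rw [this, List.append_nil]
    exact .loop_false (by simp [ofStacks, StackState.tops])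
  | cons a k ih =>
    obtain _ | ⟨b, k'⟩ := k'
    · simp at hk
    have hi : tapeOf E.input pre.length = some b := by
      rw [hx, List.append_assoc, List.cons_append, tapeOf_append_cons]
    have h := ih k' (pre ++ [b]) (by simpa using hk) (by simp [hx]) (t := a :: t)
      (f := if f = [] ∧ a = b then [] else [.comma]) (by split_ifs <;> simp)
      (by simp only [List.length_cons] at hcap ⊢; omega)
    refine .loop_true (s' := ofStacks (pre ++ [b]).length d q s k (a :: t) v
        (if f = [] ∧ a = b then [] else [.comma]))
      (by simp [ofStacks, StackState.tops]) (.act rfl ?_ (.inr ?_) (fun j => ?_) (fun j => ?_)) ?_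
    · simp [ofStacks]
    · simp [ofStacks, hx]
      omega
    · simp only [ofStacks, hi, StackState.tops]
      fin_cases j <;> try rfl
      rcases hf with rfl | rfl
      · by_cases hab : a = b <;> simp [hab, StackOp.apply]
      · simp [StackOp.apply]
    · have h4 : t.length + 1 ≤ E.cap := by
        simp only [List.length_cons] at hcap
        omega
      fin_cases j <;> simp [ofStacks, h4]
      split_ifs <;> simp [hcap']
    · have hif : (if f = [] ∧ a :: k = b :: k' then [] else [TapeSym.comma]) =
          if (if f = [] ∧ a = b then [] else [TapeSym.comma]) = [] ∧ k = k' then []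
            else [TapeSym.comma] := by
        by_cases hf' : f = [] <;> by_cases hab : a = b <;> simp [hf', hab]
      rw [hif, show pre ++ b :: k' = pre ++ [b] ++ k' by simp,
        show (a :: k).reverse ++ t = k.reverse ++ a :: t by simp]
      exact h

/-- The pair on the stack `3` is searched in the table, and its image is read onto the stack
`4`. -/
def search : Gadget 5 :=
  compare.seq (loop (fun _ r => (r 6).isSome)
    ((drain 6).seq ((transfer (fun _ => true) 4 3).seq ((readEntry 4).seq
      (forward.seq ((drain 4).seq compare))))))

/-- Induction on the rest of the table. Each round of the loop ends with a comparison; `mid` is the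
state between a comparison and the next test, so that the induction hypothesis supplies both the end
of the present round and the remaining rounds. -/
theorem exec_search {n d : ℕ} (G : LabeledGraph (Fin n) (Fin d)) (p : Fin n × Fin d)
    {D q s v : List TapeSym} (hcap : n.size + 1 + d.size + 1 ≤ E.cap)
    (l : List (Fin n × Fin d)) (hp : p ∈ l) (pre : List TapeSym)
    (hx : E.input = pre ++ l.flatMap (encodeEntry G)) :
    ∃ pre' post mid, E.input = pre' ++ (.comma :: encodeKey (G.rot p)) ++ .semicolon :: post ∧
      compare.Exec E (ofStacks pre.length D q s (encodeKey p) [] v []) mid ∧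
      (loop (fun _ r => (r 6).isSome)
        ((drain 6).seq ((transfer (fun _ => true) 4 3).seq ((readEntry 4).seq
          (forward.seq ((drain 4).seq compare)))))).Exec E mid
        (ofStacks pre'.length D q s [] (encodeKey p).reverse v []) := by
  induction l generalizing pre with
  | nil => simp at hp
  | cons p' l ih =>
    have hlen := length_encodeKey p
    have hx' : E.input = pre ++ encodeKey p' ++ ((.comma :: encodeKey (G.rot p')) ++
        [.semicolon] ++ l.flatMap (encodeEntry G)) := by
      simp [hx, encodeEntry]
    have hcomp := exec_compare (encodeKey p) (encodeKey p') pre _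
      (by rw [hlen, length_encodeKey]) hx' (d := D) (q := q) (s := s) (t := []) (v := v)
      (.inl rfl) (by simp only [hlen, List.length_nil]; omega) (by omega)
    rw [List.append_nil] at hcomp
    by_cases hpp : p = p'
    · subst hpp
      refine ⟨pre ++ encodeKey p, l.flatMap (encodeEntry G), _, by simp [hx'], hcomp, ?_⟩
      rw [if_pos ⟨rfl, rfl⟩]
      exact .loop_false rfl
    · rw [if_neg fun h => hpp (encodeKey_injective h.2)] at hcomp
      obtain ⟨pre', post, mid, h1, h2, h3⟩ := ih (List.mem_of_ne_of_mem hpp hp)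
        (pre ++ encodeEntry G p') (by simp [hx])
      refine ⟨pre', post, _, h1, hcomp, .loop_true rfl ?_ h3⟩
      have e1 : (drain 6).Exec E
          (ofStacks (pre ++ encodeKey p').length D q s [] (encodeKey p).reverse v [.comma])
          (ofStacks (pre ++ encodeKey p').length D q s [] (encodeKey p).reverse v []) :=
        exec_drain rfl (by intro j; fin_cases j <;> simp)
      have e2 : (transfer (fun _ => true) 4 3).Exec E
          (ofStacks (pre ++ encodeKey p').length D q s [] (encodeKey p).reverse v [])
          (ofStacks (pre ++ encodeKey p').length D q s (encodeKey p) [] v []) :=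
        exec_transfer (by decide) (encodeKey p).reverse [] (by simp) rfl (by simp) rfl (by simp)
          (by intro j; fin_cases j <;> simp) (by simp [hlen]; omega)
      -- The extra cell in `hcap` is used here: the image to be skipped is copied together with the
      -- comma before it.
      have e3 : (readEntry 4).Exec E
          (ofStacks (pre ++ encodeKey p').length D q s (encodeKey p) [] v [])
          (ofStacks (pre ++ encodeKey p' ++ (.comma :: encodeKey (G.rot p'))).length D q s
            (encodeKey p) (.comma :: encodeKey (G.rot p')).reverse v []) :=
        exec_readEntry _ _ (l.flatMap (encodeEntry G)) (by simp [hx'])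
          (by simp [semicolon_notMem_encodeKey]) (by simp) (by intro j; fin_cases j <;> simp)
          (by simp [length_encodeKey]; omega)
      have e4 : forward.Exec E
          (ofStacks (pre ++ encodeKey p' ++ (.comma :: encodeKey (G.rot p'))).length D q s
            (encodeKey p) (.comma :: encodeKey (G.rot p')).reverse v [])
          (ofStacks (pre ++ encodeEntry G p').length D q s
            (encodeKey p) (.comma :: encodeKey (G.rot p')).reverse v []) := exec_forward (by simp [encodeEntry]; ring) (by omega) (by
          rw [hx', Nat.cast_le]
          simp only [encodeEntry, List.length_append]
          omega)
      have e5 : (drain 4).Exec E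
          (ofStacks (pre ++ encodeEntry G p').length D q s
            (encodeKey p) (.comma :: encodeKey (G.rot p')).reverse v [])
          (ofStacks (pre ++ encodeEntry G p').length D q s (encodeKey p) [] v []) :=
        exec_drain rfl (by intro j; fin_cases j <;> simp)
      exact e1.seq (e2.seq (e3.seq (e4.seq (e5.seq h2))))

/-- The pair on the stack `3` is replaced by its image under the rotation map of `G₀`. -/
def lookup : Gadget 5 :=
  search.seq ((drain 4).seq (forward.seq ((readEntry 4).seq
    ((transfer (fun _ => true) 4 3).seq rewind))))

theorem exec_lookup {n d : ℕ} (G : LabeledGraph (Fin n) (Fin d)) (hx : E.input = encodeGraph G)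
    (p : Fin n × Fin d) {D q s v : List TapeSym} (hcap : n.size + 1 + d.size + 1 ≤ E.cap) :
    lookup.Exec E (ofStacks 0 D q s (encodeKey p) [] v [])
      (ofStacks 0 D q s (encodeKey (G.rot p)) [] v []) := by
  rw [encodeGraph_eq] at hx
  obtain ⟨pre, post, mid, hx', h1, h2⟩ := exec_search G p (D := D) (q := q) (s := s) (v := v) hcap
    _ (by simp) [] hx
  have hlen := length_encodeKey (G.rot p)
  have e1 : (drain 4).Exec E (ofStacks pre.length D q s [] (encodeKey p).reverse v [])
      (ofStacks pre.length D q s [] [] v []) :=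
    exec_drain rfl (by intro j; fin_cases j <;> simp)
  have e2 : forward.Exec E (ofStacks pre.length D q s [] [] v [])
      (ofStacks (pre ++ [TapeSym.comma]).length D q s [] [] v []) := exec_forward (by simp) (by omega) (by simp [hx']; omega)
  have e3 : (readEntry 4).Exec E (ofStacks (pre ++ [TapeSym.comma]).length D q s [] [] v [])
      (ofStacks (pre ++ [TapeSym.comma] ++ encodeKey (G.rot p)).length D q s []
        (encodeKey (G.rot p)).reverse v []) :=
    exec_readEntry _ _ post (by simp [hx']) (semicolon_notMem_encodeKey _) (by simp)
      (by intro j; fin_cases j <;> simp) (by simp [hlen]; omega)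
  have e4 : (transfer (fun _ => true) 4 3).Exec E
      (ofStacks (pre ++ [TapeSym.comma] ++ encodeKey (G.rot p)).length D q s []
        (encodeKey (G.rot p)).reverse v [])
      (ofStacks (pre ++ [TapeSym.comma] ++ encodeKey (G.rot p)).length D q s
        (encodeKey (G.rot p)) [] v []) :=
    exec_transfer (by decide) (encodeKey (G.rot p)).reverse [] (by simp) rfl (by simp) rfl (by simp)
      (by intro j; fin_cases j <;> simp) (by simp [hlen]; omega)
  have e5 : rewind.Exec E
      (ofStacks (pre ++ [TapeSym.comma] ++ encodeKey (G.rot p)).length D q s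
        (encodeKey (G.rot p)) [] v [])
      (ofStacks 0 D q s (encodeKey (G.rot p)) [] v []) := exec_rewind (by simp [hx'])
  exact (Exec.seq h1 h2).seq (e1.seq (e2.seq (e3.seq (e4.seq e5))))

end Gadget

/-! ### Scheduling of oracle calls and lookups -/

namespace Gadget

variable {E : Env}

/-- The pair on the stack `3` is moved to the stacks `5` and `1`, and the components marked by
semicolons are moved from the stack `2` to the stack `1`. -/
def scan : Gadget 5 :=
  (transfer TapeSym.isBit 3 5).seq ((drop 3).seq ((transfer (fun _ => true) 3 1).seq
    (loop (fun _ r => r 2 = some .semicolon)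
      ((exchange 2 1 .comma).seq (transfer TapeSym.isBit 2 1)))))

/-- In continuation form, because the loop may go on with `r`. The component of the highest level
lies deepest, so the induction hypothesis is applied with that component added to `r`. -/
theorem exec_scan_loop {d c : ℕ} {z : ℤ} {D q p t v f : List TapeSym} (i : ℕ)
    (x : EdgeLabel d c i) (r : List TapeSym) (hr : StartsNoBit r)
    (hcap : (x.tagged .comma i).length + q.length ≤ E.cap) {s' : StackState 5}
    (h : (loop (fun _ r => r 2 = some .semicolon)
      ((exchange 2 1 .comma).seq (transfer TapeSym.isBit 2 1))).Exec E
      (ofStacks z D ((x.tagged .comma i).reverse ++ q) r p t v f) s') :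
    (loop (fun _ r => r 2 = some .semicolon)
      ((exchange 2 1 .comma).seq (transfer TapeSym.isBit 2 1))).Exec E
      (ofStacks z D q (x.tagged .semicolon i ++ r) p t v f) s' := by
  induction i generalizing r with
  | zero => exact h
  | succ i ih =>
    simp only [EdgeLabel.tagged, List.append_assoc, List.cons_append, List.length_append,
      List.length_cons] at hcap ⊢
    refine ih x.1 _ (by simp [StartsNoBit, TapeSym.isBit]) (by omega) ?_
    have e1 : (exchange 2 1 .comma).Exec E
        (ofStacks z D ((x.1.tagged .comma i).reverse ++ q)
          (.semicolon :: (encodeFin x.2 ++ r)) p t v f)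
        (ofStacks z D (.comma :: ((x.1.tagged .comma i).reverse ++ q))
          (encodeFin x.2 ++ r) p t v f) :=
      exec_exchange (by decide) rfl rfl (by intro j; fin_cases j <;> simp) (by simp; omega)
    have e2 : (transfer TapeSym.isBit 2 1).Exec E
        (ofStacks z D (.comma :: ((x.1.tagged .comma i).reverse ++ q))
          (encodeFin x.2 ++ r) p t v f)
        (ofStacks z D (((x.tagged .comma (i + 1)).reverse ++ q)) r p t v f) :=
      exec_transfer (by decide) _ _ (isBit_of_mem_encodeFin _) hr rfl rfl
        (by simp [EdgeLabel.tagged]) (by intro j; fin_cases j <;> simp)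
        (by simp [EdgeLabel.tagged]; omega)
    exact .loop_true (by simp [ofStacks, StackState.tops]) (e1.seq e2) h

/-- The finished levels, together with the label of `G₀`, make up a label of level `i`, already
spelled as the beginning of a query. By `hr'`, the next level is not finished or does not exist. -/
theorem exec_scan {n d c : ℕ} {z : ℤ} {D : List TapeSym} (i : ℕ) (v : Fin n)
    (x : EdgeLabel d c i) (r : List TapeSym) (hr : StartsNoBit r)
    (hr' : r.head? ≠ some .semicolon)
    (hcap : n.size + 1 + d.size + i * (c.size + 1) ≤ E.cap) :
    scan.Exec E (ofStacks z D [] (x.tagged .semicolon i ++ r) (encodeKey (v, x.first i)) [] [] [])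
      (ofStacks z D (encodeLabel i x).reverse r [] [] (encodeFin v).reverse []) := by
  have e1 : (transfer TapeSym.isBit 3 5).Exec E
      (ofStacks z D [] (x.tagged .semicolon i ++ r) (encodeKey (v, x.first i)) [] [] [])
      (ofStacks z D [] (x.tagged .semicolon i ++ r) (.comma :: encodeFin (x.first i)) []
        (encodeFin v).reverse []) :=
    exec_transfer (by decide) _ _ (isBit_of_mem_encodeFin v) rfl rfl rfl (by simp)
      (by intro j; fin_cases j <;> simp) (by simp [length_encodeFin]; omega)
  have e2 : (drop 3).Exec E
      (ofStacks z D [] (x.tagged .semicolon i ++ r) (.comma :: encodeFin (x.first i)) []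
        (encodeFin v).reverse [])
      (ofStacks z D [] (x.tagged .semicolon i ++ r) (encodeFin (x.first i)) []
        (encodeFin v).reverse []) :=
    exec_drop rfl (by intro j; fin_cases j <;> simp)
  have e3 : (transfer (fun _ => true) 3 1).Exec E
      (ofStacks z D [] (x.tagged .semicolon i ++ r) (encodeFin (x.first i)) []
        (encodeFin v).reverse [])
      (ofStacks z D (encodeFin (x.first i)).reverse (x.tagged .semicolon i ++ r) [] []
        (encodeFin v).reverse []) :=
    exec_transfer (by decide) (encodeFin (x.first i)) [] (by simp) rfl (by simp) rfl (by simp)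
      (by intro j; fin_cases j <;> simp) (by simp [length_encodeFin]; omega)
  refine e1.seq (e2.seq (e3.seq (exec_scan_loop i x r hr ?_ ?_)))
  · simp [length_encodeFin, EdgeLabel.length_tagged]
    omega
  · rw [encodeLabel_eq, List.reverse_append]
    exact .loop_false (decide_eq_false hr')

/-- The next component is moved from the stack `2` to the stack `1`, the oracle is called, and the
answer is moved to the stacks `3` and `2`. -/
def askOracle : Gadget 5 :=
  (exchange 2 1 .comma).seq ((transfer TapeSym.isBit 2 1).seq (call.seq
    ((transfer TapeSym.isBit 1 2).seq ((exchange 1 2 .semicolon).seq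
      ((transfer (fun _ => true) 1 2).seq ((transfer TapeSym.isBit 2 4).seq
        ((transfer (fun _ => true) 4 3).seq ((put 3 .comma).seq
          (transfer (fun _ => true) 5 3)))))))))

/-- This is the carry of the counter: the lower components return with commas, that is, with both
inner evaluations ahead, and the component of `a` now has a semicolon. -/
theorem exec_askOracle {n d c k : ℕ} (H : (i : Fin k) → LabeledGraph (EdgeLabel d c i) (Fin c))
    (hE : E.oracle = oracleCall H) {z : ℤ} {D : List TapeSym} (i : Fin k) (v : Fin n)
    (x x' : EdgeLabel d c i) (a a' : Fin c) (ha : (H i).rot (x, a) = (x', a'))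
    (r : List TapeSym) (hr : StartsNoBit r)
    (hcap : n.size + 1 + d.size + (i + 1) * (c.size + 1) + r.length ≤ E.cap) :
    askOracle.Exec E
      (ofStacks z D (encodeLabel i x).reverse (.comma :: (encodeFin a ++ r)) [] []
        (encodeFin v).reverse [])
      (ofStacks z D [] (x'.tagged .comma i ++ .semicolon :: (encodeFin a' ++ r))
        (encodeKey (v, x'.first i)) [] [] []) := by
  have hlen : ∀ y : EdgeLabel d c i, (encodeLabel i y).length = d.size + i * (c.size + 1) :=
    fun y => by rw [encodeLabel_eq, List.length_append, length_encodeFin, y.length_tagged]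
  rw [add_one_mul] at hcap
  have e1 : (exchange 2 1 .comma).Exec E
      (ofStacks z D (encodeLabel i x).reverse (.comma :: (encodeFin a ++ r)) [] []
        (encodeFin v).reverse [])
      (ofStacks z D (.comma :: (encodeLabel i x).reverse) (encodeFin a ++ r) [] []
        (encodeFin v).reverse []) :=
    exec_exchange (by decide) rfl rfl (by intro j; fin_cases j <;> simp) (by simp [hlen]; omega)
  have e2 : (transfer TapeSym.isBit 2 1).Exec E
      (ofStacks z D (.comma :: (encodeLabel i x).reverse) (encodeFin a ++ r) [] []
        (encodeFin v).reverse [])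
      (ofStacks z D (encodeQuery i (x, a)).reverse r [] [] (encodeFin v).reverse []) :=
    exec_transfer (by decide) _ _ (isBit_of_mem_encodeFin _) hr rfl rfl
      (by simp [encodeQuery]) (by intro j; fin_cases j <;> simp)
      (by simp [encodeQuery, hlen, length_encodeFin]; omega)
  have e3 : call.Exec E
      (ofStacks z D (encodeQuery i (x, a)).reverse r [] [] (encodeFin v).reverse [])
      (ofStacks z D (encodeQuery i (x', a')).reverse r [] [] (encodeFin v).reverse []) := by
    refine Exec.call rfl ?_ ?_ (by intro j; fin_cases j <;> simp [ofStacks])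
    · simp [ofStacks, hE, oracleCall_query, ha]
    · simp [ofStacks, encodeQuery, hlen, length_encodeFin]
  have e4 : (transfer TapeSym.isBit 1 2).Exec E
      (ofStacks z D (encodeQuery i (x', a')).reverse r [] [] (encodeFin v).reverse [])
      (ofStacks z D (.comma :: (encodeLabel i x').reverse) (encodeFin a' ++ r) [] []
        (encodeFin v).reverse []) :=
    exec_transfer (by decide) (encodeFin a').reverse _
      (fun b hb => isBit_of_mem_encodeFin a' b (List.mem_reverse.mp hb)) rfl
      (by simp [encodeQuery]) rfl (by simp) (by intro j; fin_cases j <;> simp)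
      (by simp [length_encodeFin]; omega)
  have e5 : (exchange 1 2 .semicolon).Exec E
      (ofStacks z D (.comma :: (encodeLabel i x').reverse) (encodeFin a' ++ r) [] []
        (encodeFin v).reverse [])
      (ofStacks z D (encodeLabel i x').reverse (.semicolon :: (encodeFin a' ++ r)) [] []
        (encodeFin v).reverse []) :=
    exec_exchange (by decide) rfl rfl (by intro j; fin_cases j <;> simp)
      (by simp [length_encodeFin]; omega)
  have e6 : (transfer (fun _ => true) 1 2).Exec E
      (ofStacks z D (encodeLabel i x').reverse (.semicolon :: (encodeFin a' ++ r)) [] []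
        (encodeFin v).reverse [])
      (ofStacks z D [] (encodeLabel i x' ++ .semicolon :: (encodeFin a' ++ r)) [] []
        (encodeFin v).reverse []) :=
    exec_transfer (by decide) (encodeLabel i x').reverse [] (by simp) rfl (by simp) rfl (by simp)
      (by intro j; fin_cases j <;> simp) (by simp [hlen, length_encodeFin]; omega)
  have e7 : (transfer TapeSym.isBit 2 4).Exec E
      (ofStacks z D [] (encodeLabel i x' ++ .semicolon :: (encodeFin a' ++ r)) [] []
        (encodeFin v).reverse [])
      (ofStacks z D [] (x'.tagged .comma i ++ .semicolon :: (encodeFin a' ++ r)) []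
        (encodeFin (x'.first i)).reverse (encodeFin v).reverse []) :=
    exec_transfer (by decide) (encodeFin (x'.first i)) _ (isBit_of_mem_encodeFin _)
      (StartsNoBit.tagged_append (r := .semicolon :: (encodeFin a' ++ r)) rfl i x' rfl) (by simp [encodeLabel_eq]) rfl (by simp)
      (by intro j; fin_cases j <;> simp) (by simp [length_encodeFin]; omega)
  have e8 : (transfer (fun _ => true) 4 3).Exec E
      (ofStacks z D [] (x'.tagged .comma i ++ .semicolon :: (encodeFin a' ++ r)) []
        (encodeFin (x'.first i)).reverse (encodeFin v).reverse [])
      (ofStacks z D [] (x'.tagged .comma i ++ .semicolon :: (encodeFin a' ++ r))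
        (encodeFin (x'.first i)) [] (encodeFin v).reverse []) :=
    exec_transfer (by decide) (encodeFin (x'.first i)).reverse [] (by simp) rfl (by simp) rfl
      (by simp) (by intro j; fin_cases j <;> simp) (by simp [length_encodeFin]; omega)
  have e9 : (put 3 .comma).Exec E
      (ofStacks z D [] (x'.tagged .comma i ++ .semicolon :: (encodeFin a' ++ r))
        (encodeFin (x'.first i)) [] (encodeFin v).reverse [])
      (ofStacks z D [] (x'.tagged .comma i ++ .semicolon :: (encodeFin a' ++ r))
        (.comma :: encodeFin (x'.first i)) [] (encodeFin v).reverse []) :=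
    exec_put rfl (by intro j; fin_cases j <;> simp) (by simp [length_encodeFin]; omega)
  have e10 : (transfer (fun _ => true) 5 3).Exec E
      (ofStacks z D [] (x'.tagged .comma i ++ .semicolon :: (encodeFin a' ++ r))
        (.comma :: encodeFin (x'.first i)) [] (encodeFin v).reverse [])
      (ofStacks z D [] (x'.tagged .comma i ++ .semicolon :: (encodeFin a' ++ r))
        (encodeKey (v, x'.first i)) [] [] []) :=
    exec_transfer (by decide) (encodeFin v).reverse [] (by simp) rfl (by simp) rfl
      (by simp [encodeKey]) (by intro j; fin_cases j <;> simp)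
      (by simp [length_encodeKey]; omega)
  exact e1.seq (e2.seq (e3.seq (e4.seq (e5.seq (e6.seq (e7.seq (e8.seq (e9.seq e10))))))))

/-- The separators on the stack `2` serve as the digits of a binary counter (comma for zero and
semicolon for one); its carries tell which oracle is due between two lookups. -/
def mainLoop : Gadget 5 :=
  loop (fun _ r => (r 2).isSome) (askOracle.seq (lookup.seq scan))

/-- In continuation form: if `s'` is reached from the end of an evaluation at level `i`, it is
reached from its beginning. Such an evaluation begins at a lookup, which lies before the loop or in
the middle of its body; `s₁` and `s₂` are the cuts at which `seq` and the loop rule fit together. -/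
theorem exec_mainLoop {n d c k : ℕ} (G : LabeledGraph (Fin n) (Fin d))
    (H : (i : Fin k) → LabeledGraph (EdgeLabel d c i) (Fin c)) (hG : E.input = encodeGraph G)
    (hE : E.oracle = oracleCall H) {D : List TapeSym} {s' : StackState 5} (i : ℕ) (hi : i ≤ k)
    (v : Fin n) (x : EdgeLabel d c i) (r : List TapeSym) (hr : StartsNoBit r)
    (hcap : n.size + 1 + d.size + i * (c.size + 1) + r.length ≤ E.cap)
    (hcap' : n.size + 1 + d.size + 1 ≤ E.cap)
    (h : ∃ s₂, scan.Exec E (ofStacks 0 D []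
        (((iteratedSquare G H i hi).rot (v, x)).2.tagged .semicolon i ++ r)
        (encodeKey (((iteratedSquare G H i hi).rot (v, x)).1,
          ((iteratedSquare G H i hi).rot (v, x)).2.first i)) [] [] []) s₂ ∧
      mainLoop.Exec E s₂ s') :
    ∃ s₁ s₂, lookup.Exec E
        (ofStacks 0 D [] (x.tagged .comma i ++ r) (encodeKey (v, x.first i)) [] [] []) s₁ ∧
      scan.Exec E s₁ s₂ ∧ mainLoop.Exec E s₂ s' := by
  induction i generalizing v r with
  | zero =>
    obtain ⟨s₂, h1, h2⟩ := h
    exact ⟨_, s₂, exec_lookup G hG (v, x) hcap', h1, h2⟩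
  | succ i ih =>
    obtain ⟨x, a⟩ := x
    have hi' : i ≤ k := Nat.le_of_succ_le hi
    rcases h1 : (iteratedSquare G H i hi').rot (v, x) with ⟨v₁, x₁⟩
    rcases h2 : (H ⟨i, hi⟩).rot (x₁, a) with ⟨x₂, a₂⟩
    rcases h3 : (iteratedSquare G H i hi').rot (v₁, x₂) with ⟨v₃, x₃⟩
    have hrot : (iteratedSquare G H (i + 1) hi).rot (v, (x, a)) = (v₃, (x₃, a₂)) := by
      simp only [iteratedSquare, LabeledGraph.derandSquare, h1, h2, h3]
      rfl
    rw [hrot] at h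
    simp only [EdgeLabel.tagged, EdgeLabel.first, List.append_assoc, List.cons_append] at h ⊢
    rw [add_one_mul] at hcap
    -- The first inner evaluation, with a comma still in front of `a`.
    refine ih hi' v x _ rfl ?_ ?_
    · simp [length_encodeFin]
      omega
    · rw [h1]
      refine ⟨_, exec_scan i v₁ x₁ _ rfl (by simp) (by omega), ?_⟩
      -- The second inner evaluation, with a semicolon in front of `a₂`. At its end all `i + 1`
      -- components carry semicolons, which is the starting point of `h`.
      obtain ⟨s₁, s₂, g1, g2, g3⟩ := ih hi' v₁ x₂ (.semicolon :: (encodeFin a₂ ++ r)) rfl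
        (by simp [length_encodeFin]; omega) (by rw [h3]; exact h)
      exact .loop_true rfl ((exec_askOracle H hE ⟨i, hi⟩ v₁ x₁ x₂ a a₂ h2 r hr
        (by simp only; rw [add_one_mul]; omega)).seq (g1.seq g2)) g3

/-- The computation on stacks. -/
def program : Gadget 5 :=
  (transfer (fun _ => true) 0 2).seq ((transfer TapeSym.isBit 2 4).seq ((exchange 2 4 .comma).seq
    ((transfer TapeSym.isBit 2 4).seq ((transfer (fun _ => true) 4 3).seq (lookup.seq
      (scan.seq (mainLoop.seq ((transfer (fun _ => true) 5 4).seq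
        ((transfer (fun _ => true) 4 0).seq ((put 0 .comma).seq
          ((transfer (fun _ => true) 1 4).seq (transfer (fun _ => true) 4 0))))))))))))

theorem exec_program {n d c k : ℕ} (G : LabeledGraph (Fin n) (Fin d))
    (H : (i : Fin k) → LabeledGraph (EdgeLabel d c i) (Fin c)) (hG : E.input = encodeGraph G)
    (hE : E.oracle = oracleCall H) (i : ℕ) (hi : i ≤ k) (p : Fin n × EdgeLabel d c i)
    (hcap : n.size + 1 + d.size + i * (c.size + 1) = E.cap) (hi₀ : 1 ≤ i) :
    program.Exec E (ofStacks 0 (encodePair i p).reverse [] [] [] [] [] [])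
      (ofStacks 0 (encodePair i ((iteratedSquare G H i hi).rot p)).reverse [] [] [] [] [] []) := by
  obtain ⟨v, x⟩ := p
  rcases hrot : (iteratedSquare G H i hi).rot (v, x) with ⟨v', x'⟩
  have hlen : ∀ y : EdgeLabel d c i, (encodeLabel i y).length = d.size + i * (c.size + 1) :=
    fun y => by rw [encodeLabel_eq, List.length_append, length_encodeFin, y.length_tagged]
  -- The extra cell required by `exec_lookup` comes from the at least one component in `[c]`.
  have hcap' : n.size + 1 + d.size + 1 ≤ E.cap := by
    have : 1 * 1 ≤ i * (c.size + 1) := Nat.mul_le_mul hi₀ (by omega)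
    omega
  have e1 : (transfer (fun _ => true) 0 2).Exec E
      (ofStacks 0 (encodePair i (v, x)).reverse [] [] [] [] [] [])
      (ofStacks 0 [] [] (encodePair i (v, x)) [] [] [] []) :=
    exec_transfer (by decide) (encodePair i (v, x)).reverse [] (by simp) rfl (by simp) rfl (by simp)
      (by intro j; fin_cases j <;> simp) (by simp [encodePair, hlen, length_encodeFin]; omega)
  have e2 : (transfer TapeSym.isBit 2 4).Exec E
      (ofStacks 0 [] [] (encodePair i (v, x)) [] [] [] [])
      (ofStacks 0 [] [] (.comma :: encodeLabel i x) [] (encodeFin v).reverse [] []) :=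
    exec_transfer (by decide) (encodeFin v) _ (isBit_of_mem_encodeFin _) rfl (by simp [encodePair])
      rfl (by simp) (by intro j; fin_cases j <;> simp) (by simp [length_encodeFin]; omega)
  have e3 : (exchange 2 4 .comma).Exec E
      (ofStacks 0 [] [] (.comma :: encodeLabel i x) [] (encodeFin v).reverse [] [])
      (ofStacks 0 [] [] (encodeLabel i x) [] (.comma :: (encodeFin v).reverse) [] []) :=
    exec_exchange (by decide) rfl rfl (by intro j; fin_cases j <;> simp)
      (by simp [length_encodeFin]; omega)
  have e4 : (transfer TapeSym.isBit 2 4).Exec E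
      (ofStacks 0 [] [] (encodeLabel i x) [] (.comma :: (encodeFin v).reverse) [] [])
      (ofStacks 0 [] [] (x.tagged .comma i ++ []) [] (encodeKey (v, x.first i)).reverse [] []) :=
    exec_transfer (by decide) (encodeFin (x.first i)) _ (isBit_of_mem_encodeFin _)
      (StartsNoBit.tagged_append (r := []) rfl i x rfl) (by simp [encodeLabel_eq])
      rfl (by simp [encodeKey]) (by intro j; fin_cases j <;> simp)
      (by simp [length_encodeKey]; omega)
  have e5 : (transfer (fun _ => true) 4 3).Exec E
      (ofStacks 0 [] [] (x.tagged .comma i ++ []) [] (encodeKey (v, x.first i)).reverse [] [])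
      (ofStacks 0 [] [] (x.tagged .comma i ++ []) (encodeKey (v, x.first i)) [] [] []) :=
    exec_transfer (by decide) (encodeKey (v, x.first i)).reverse [] (by simp) rfl (by simp) rfl
      (by simp) (by intro j; fin_cases j <;> simp) (by simp [length_encodeKey]; omega)
  -- For `r = []` the last scan empties the stack `2`, which ends the loop.
  obtain ⟨s₁, s₂, h1, h2, h3⟩ := exec_mainLoop G H hG hE (D := []) i hi v x [] rfl
    (by simp [hcap]) hcap'
    ⟨_, exec_scan i _ _ [] rfl (by simp) hcap.le, .loop_false rfl⟩
  rw [hrot] at h3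
  have e6 : (transfer (fun _ => true) 5 4).Exec E
      (ofStacks 0 [] (encodeLabel i x').reverse [] [] [] (encodeFin v').reverse [])
      (ofStacks 0 [] (encodeLabel i x').reverse [] [] (encodeFin v') [] []) :=
    exec_transfer (by decide) (encodeFin v').reverse [] (by simp) rfl (by simp) rfl (by simp)
      (by intro j; fin_cases j <;> simp) (by simp [length_encodeFin]; omega)
  have e7 : (transfer (fun _ => true) 4 0).Exec E
      (ofStacks 0 [] (encodeLabel i x').reverse [] [] (encodeFin v') [] [])
      (ofStacks 0 (encodeFin v').reverse (encodeLabel i x').reverse [] [] [] [] []) :=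
    exec_transfer (by decide) (encodeFin v') [] (by simp) rfl (by simp) rfl (by simp)
      (by intro j; fin_cases j <;> simp) (by simp [length_encodeFin]; omega)
  have e8 : (put 0 .comma).Exec E
      (ofStacks 0 (encodeFin v').reverse (encodeLabel i x').reverse [] [] [] [] [])
      (ofStacks 0 (.comma :: (encodeFin v').reverse) (encodeLabel i x').reverse [] [] [] [] []) :=
    exec_put rfl (by intro j; fin_cases j <;> simp) (by simp [length_encodeFin]; omega)
  have e9 : (transfer (fun _ => true) 1 4).Exec E
      (ofStacks 0 (.comma :: (encodeFin v').reverse) (encodeLabel i x').reverse [] [] [] [] [])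
      (ofStacks 0 (.comma :: (encodeFin v').reverse) [] [] [] (encodeLabel i x') [] []) :=
    exec_transfer (by decide) (encodeLabel i x').reverse [] (by simp) rfl (by simp) rfl (by simp)
      (by intro j; fin_cases j <;> simp) (by simp [hlen]; omega)
  have e10 : (transfer (fun _ => true) 4 0).Exec E
      (ofStacks 0 (.comma :: (encodeFin v').reverse) [] [] [] (encodeLabel i x') [] [])
      (ofStacks 0 (encodePair i (v', x')).reverse [] [] [] [] [] []) :=
    exec_transfer (by decide) (encodeLabel i x') [] (by simp) rfl (by simp) rfl
      (by simp [encodePair]) (by intro j; fin_cases j <;> simp)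
      (by simp [encodePair, hlen, length_encodeFin]; omega)
  exact e1.seq (e2.seq (e3.seq (e4.seq (e5.seq (h1.seq (h2.seq (h3.seq (e6.seq (e7.seq
    (e8.seq (e9.seq e10)))))))))))

end Gadget

/-! ### From stacks to the calling convention -/

namespace Gadget

/-- The heads of all tapes but the data tape are moved by one cell before and after the computation
on stacks. -/
def fullProgram : Gadget 5 :=
  (single fun t => if t = 0 then 0 else -1).seq
    (program.seq (single fun t => if t = 0 then 0 else 1))

/-- Passing arguments and values. -/
def ioMemory (y : List TapeSym) (rest : ℤ → Option TapeSym) : Memory 5 where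
  inPos := 0
  tape := fun t => if t = 0 then overlay y rest else fun _ => none
  pos := fun t => if t = 0 then (y.length : ℤ) - 1 else 0

theorem ofStacks_tape {E : Env} {y : List TapeSym} (hy : y.length = E.cap) (t : Fin 7) :
    ((ofStacks 0 y.reverse [] [] [] [] [] []).mem E).tape t =
      (ioMemory y E.base).tape t := by
  have h0 : stackTape E.cap (fun _ => none) [] = fun _ => none := by
    funext z
    simp [stackTape]
  by_cases ht : t = 0
  · subst ht
    simp [StackState.mem, ofStacks, ioMemory, ← hy, stackTape_reverse]
  · have hs : (ofStacks 0 y.reverse [] [] [] [] [] []).stk t = [] := by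
      fin_cases t <;> simp [ofStacks] at ht ⊢
    simp [StackState.mem, ioMemory, ht, hs, h0]

/-- Empty stacks have their heads in the cell `-1`, whereas the convention for blank tapes is the
cell `0`. -/
theorem ofStacks_pos {E : Env} {y : List TapeSym} (t : Fin 7) :
    ((ofStacks 0 y.reverse [] [] [] [] [] []).mem E).pos t =
      (ioMemory y E.base).pos t + if t = 0 then 0 else -1 := by
  by_cases ht : t = 0
  · subst ht
    simp [StackState.mem, ofStacks, ioMemory]
  · have hs : (ofStacks 0 y.reverse [] [] [] [] [] []).stk t = [] := by
      fin_cases t <;> simp [ofStacks] at ht ⊢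
    simp [StackState.mem, ioMemory, ht, hs]

theorem ioMemory_within {E : Env} {y : List TapeSym} (hy : y.length = E.cap) (hcap : 1 ≤ E.cap) :
    (ioMemory y E.base).Within E := fun t => by
  simp only [ioMemory]
  split_ifs <;> omega

theorem fullProgram_path {n d c k : ℕ} {E : Env} (G : LabeledGraph (Fin n) (Fin d))
    (H : (i : Fin k) → LabeledGraph (EdgeLabel d c i) (Fin c)) (hG : E.input = encodeGraph G)
    (hE : E.oracle = oracleCall H) (i : ℕ) (hi : i ≤ k) (p : Fin n × EdgeLabel d c i)
    (hcap : n.size + 1 + d.size + i * (c.size + 1) = E.cap) (hi₀ : 1 ≤ i) :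
    fullProgram.Path E (some fullProgram.start) (ioMemory (encodePair i p) E.base) none
      (ioMemory (encodePair i ((iteratedSquare G H i hi).rot p)) E.base) := by
  have hlen : ∀ q : Fin n × EdgeLabel d c i, (encodePair i q).length = E.cap := fun q => by
    rw [encodePair, encodeLabel_eq]
    simp [length_encodeFin, q.2.length_tagged]
    omega
  have hok : ∀ q : Fin n × EdgeLabel d c i,
      (ofStacks 0 (encodePair i q).reverse [] [] [] [] [] []).Ok E := fun q => by
    refine ⟨by simp [ofStacks], by simp [ofStacks], fun t => ?_⟩
    fin_cases t <;> simp [ofStacks, hlen]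
  have hp := exec_program G H hG hE i hi p hcap hi₀ (hok p)
  refine (Path.single (ioMemory_within (hlen _) (by omega)) (hok p).within ?_).seq
    (hp.2.seq (Path.single (hok _).within (ioMemory_within (hlen _) (by omega)) ?_))
  · refine Memory.ext ?_ ?_ ?_
    · simp [Memory.move, ioMemory, StackState.mem, ofStacks]
    · funext t
      rw [ofStacks_tape (hlen _)]
      simp [Memory.move, Memory.symbols]
    · funext t
      rw [ofStacks_pos]
      simp only [Memory.move]
      split_ifs <;> rfl
  · refine Memory.ext ?_ ?_ ?_
    · simp [Memory.move, ioMemory, StackState.mem, ofStacks]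
    · funext t
      rw [← ofStacks_tape (hlen _)]
      simp [Memory.move, Memory.symbols]
    · funext t
      simp only [Memory.move]
      rw [ofStacks_pos]
      split_ifs <;> simp

end Gadget

/-! ### Space estimate -/

theorem natSize_le_logb {n : ℕ} (hn : 1 ≤ n) : (n.size : ℝ) ≤ Real.logb 2 n + 1 := by
  have h0 : 0 < n.size := Nat.size_pos.mpr hn
  have h1 : 2 ^ (n.size - 1) ≤ n := Nat.lt_size.mp (by omega)
  have h2 : ((n.size - 1 : ℕ) : ℝ) ≤ Real.logb 2 n := by
    rw [Real.le_logb_iff_rpow_le (by norm_num) (by exact_mod_cast hn), Real.rpow_natCast]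
    exact_mod_cast h1
  rw [Nat.cast_sub h0] at h2
  push_cast at h2
  linarith

/-- Each of the three sizes is at most a logarithm plus 1. Write `m` for `Real.logb 2 (max c 2)`,
which is at least 1. The components in `[c]` contribute at most `k * (m + 2) ≤ 3 * k * m`, and the
remaining constant 4 is at most `4 * k * m`. -/
theorem encodedLength_le {n d c k i : ℕ} (hn : 1 ≤ n) (hd : 1 ≤ d) (hc : 1 ≤ c) (hi : i + 1 ≤ k) :
    ((n.size + 1 + d.size + (i + 1) * (c.size + 1) + 1 : ℕ) : ℝ) ≤
      7 * (Real.logb 2 (n * d) + k * Real.logb 2 (max c 2)) := by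
  have hn' := natSize_le_logb hn
  have hd' := natSize_le_logb hd
  have hc' := natSize_le_logb hc
  have hnd : Real.logb 2 (n * d) = Real.logb 2 n + Real.logb 2 d :=
    Real.logb_mul (by positivity) (by positivity)
  have hcm : Real.logb 2 c ≤ Real.logb 2 (max c 2) :=
    Real.logb_le_logb_of_le (by norm_num) (by exact_mod_cast hc) (le_max_left _ _)
  have h2m : 1 ≤ Real.logb 2 (max c 2) := by
    have := Real.logb_le_logb_of_le (b := 2) (by norm_num) (by norm_num)
      (le_max_right (c : ℝ) 2)
    rwa [Real.logb_self_eq_one (by norm_num)] at this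
  have hn0 : 0 ≤ Real.logb 2 n := Real.logb_nonneg (by norm_num) (by exact_mod_cast hn)
  have hd0 : 0 ≤ Real.logb 2 d := Real.logb_nonneg (by norm_num) (by exact_mod_cast hd)
  have hik : ((i : ℝ) + 1) ≤ k := by exact_mod_cast hi
  have hk1 : (1 : ℝ) ≤ k := by exact_mod_cast (show 1 ≤ k by omega)
  have hmul : ((i : ℝ) + 1) * ((c.size : ℝ) + 1) ≤ k * (3 * Real.logb 2 (max c 2)) :=
    mul_le_mul hik (by linarith) (by positivity) (by linarith)
  have hk2 : 1 * 1 ≤ (k : ℝ) * Real.logb 2 (max c 2) :=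
    mul_le_mul hk1 h2m (by norm_num) (by linarith)
  push_cast
  rw [hnd]
  linarith

theorem OracleMachine.space_le {M : OracleMachine} {x : List TapeSym}
    {O : (ℤ → Option TapeSym) → ℤ → Option TapeSym} {γ : M.Cfg} {T : ℕ} {L : ℕ}
    (h : ∀ s ≤ T, ∀ t, -1 ≤ (M.run x O γ s).pos t ∧ (M.run x O γ s).pos t < L) :
    M.space x O γ T ≤ (M.workTapes + 2) * (L + 1) := by
  have hc : ∀ t, ((Finset.range (T + 1)).image fun s => (M.run x O γ s).pos t).card ≤ L + 1 := by
    intro t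
    have hsub : ((Finset.range (T + 1)).image fun s => (M.run x O γ s).pos t) ⊆
        Finset.Ico (-1) (L : ℤ) := by
      intro z hz
      obtain ⟨s, hs, rfl⟩ := Finset.mem_image.mp hz
      exact Finset.mem_Ico.mpr (h s (by simpa [Nat.lt_succ_iff] using hs) t)
    refine (Finset.card_le_card hsub).trans ?_
    simp
  calc M.space x O γ T ≤ ∑ _t : Fin (M.workTapes + 2), (L + 1) :=
        Finset.sum_le_sum fun t _ => hc t
    _ = _ := by simp

theorem mainTheorem11 :
    ∃ (M : OracleMachine) (K : ℝ),
      ∀ (n d c k : ℕ) (G₀ : LabeledGraph (Fin n) (Fin d))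
        (H : (i : Fin k) → LabeledGraph (EdgeLabel d c i) (Fin c))
        (i : Fin k) (v₀ : Fin n) (i₀ : EdgeLabel d c i) (j₀ : Fin c),
        M.ComputesInSpace (encodeGraph G₀) (oracleCall H)
          (encodePair (d := d) (c := c) (i + 1) (v₀, (i₀, j₀)))
          (encodePair (d := d) (c := c) (i + 1)
            ((iteratedSquare G₀ H (i + 1) i.isLt).rot (v₀, (i₀, j₀))))
          (K * (Real.logb 2 (n * d) + k * Real.logb 2 (max c 2))) := by
  -- Seven read-write tapes, times the constant 7 of `encodedLength_le`.
  refine ⟨Gadget.fullProgram.toMachine, 49, ?_⟩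
  intro n d c k G₀ H i v₀ i₀ j₀ rest hrest
  let E : Env := ⟨encodeGraph G₀, oracleCall H, rest, hrest,
    n.size + 1 + d.size + ((i : ℕ) + 1) * (c.size + 1)⟩
  obtain ⟨T, hT, hpos⟩ := (Gadget.fullProgram_path (E := E) G₀ H rfl rfl (i + 1) i.isLt
    (v₀, (i₀, j₀)) rfl (by omega)).run
  refine ⟨T, none, hT, rfl, ?_⟩
  have hs := OracleMachine.space_le (L := E.cap) hpos
  have hl := encodedLength_le (n := n) (d := d) (c := c) (k := k) (i := i) v₀.pos
    (i₀.first i).pos j₀.pos i.isLt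
  calc (_ : ℝ) ≤ (((5 + 2) * (E.cap + 1) : ℕ) : ℝ) := Nat.cast_le.mpr hs
    _ = 7 * ((E.cap + 1 : ℕ) : ℝ) := by push_cast; ring
    _ ≤ 7 * (7 * (Real.logb 2 (n * d) + k * Real.logb 2 (max c 2))) :=
        mul_le_mul_of_nonneg_left hl (by norm_num)
    _ = _ := by ring
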